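/- There is an absolute constant $C>0$ such that the following holds. Let $n\ge 1$, let $\Omega\subset\mathbb R^n$ be open, and let $V:\mathbb R^n\to\mathbb R$ be bounded and continuous with $V(x)>0$ for all $x\in\Omega$ and $V(x)\ge 0$ for all $x\in\mathbb R^n$. Let $u_0\in H^2(\mathbb R^n)$ and $u_1\in L^2(\mathbb R^n)$ be real-valued, with $\operatorname{supp}u_1\subset\Omega$ (essential support) and $$J_{0,p}^2:=\int_\Omega\frac{|u_1(x)|^2}{V(x)}\,dx<+\infty .$$ Then the Cauchy problem $$u_{tt}+\Delta^2u+V(x)u=0\quad (t>0,\ x\in\mathbb R^n),\qquad u(0,x)=u_0(x),\quad u_t(0,x)=u_1(x)\quad (x\in\mathbb R^n),$$ has a unique weak solution $u\in C([0,\infty);H^2(\mathbb R^n))\cap C^1([0,\infty);L^2(\mathbb R^n))$, and it satisfies $$\|u(t,\cdot)\|^2\le C\,\bigl(\|u_0\|^2+J_{0,p}^2\bigr)\qquad (t\ge 0),$$ where $\|\cdot\|$ is the norm of $L^2(\mathbb R^n)$. Here $u$ in the stated class is a weak solution if it attains the initial data and, for every $\varphi\in H^2(\mathbb R^n)$ and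 every $t>0$, $$\frac{d}{dt}\int_{\mathbb R^n}u_t(t,x)\varphi(x)\,dx+\int_{\mathbb R^n}\Delta u(t,x)\,\Delta\varphi(x)\,dx+\int_{\mathbb R^n}V(x)u(t,x)\varphi(x)\,dx=0 .$$ -/

import Mathlib

open MeasureTheory Set
open scoped ContDiff BoundedContinuousFunction

noncomputable section

namespace PlateEq

/-- Euclidean space `ℝⁿ`. -/
abbrev Space (n : ℕ) : Type := EuclideanSpace ℝ (Fin n)

/-- The real Hilbert space `L²(ℝⁿ)` of real-valued functions, with Lebesgue measure. -/
abbrev L2 (n : ℕ) : Type := Lp ℝ 2 (volume : Measure (Space n))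

/-- `g ∈ L²(ℝⁿ)` is the weak partial derivative `∂f/∂xᵢ` of `f ∈ L²(ℝⁿ)`:
`∫ f ∂ᵢφ = - ∫ g φ` for every `φ ∈ C_c^∞(ℝⁿ)`. -/
def HasWeakPartial {n : ℕ} (i : Fin n) (f g : L2 n) : Prop :=
  ∀ φ : Space n → ℝ, ContDiff ℝ ∞ φ → HasCompactSupport φ →
    ∫ x, f x * fderiv ℝ φ x (EuclideanSpace.single i 1) = - ∫ x, g x * φ x

theorem integrable_mul_of_test {n : ℕ} (f : L2 n) {φ : Space n → ℝ} (hφ : Continuous φ)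
    (hc : HasCompactSupport φ) : Integrable (fun x => f x * φ x) :=
  (Lp.memLp f).integrable_mul (q := 2) (hφ.memLp_of_hasCompactSupport hc)

theorem continuous_partial {n : ℕ} (i : Fin n) {φ : Space n → ℝ} (hφ : ContDiff ℝ ∞ φ) :
    Continuous (fun x => fderiv ℝ φ x (EuclideanSpace.single i 1)) :=
  (hφ.continuous_fderiv (by simp)).clm_apply continuous_const

theorem hasCompactSupport_partial {n : ℕ} (i : Fin n) {φ : Space n → ℝ}
    (hc : HasCompactSupport φ) :
    HasCompactSupport (fun x => fderiv ℝ φ x (EuclideanSpace.single i 1)) :=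
  hc.fderiv_apply ℝ _

theorem integral_add_mul {n : ℕ} (f f' : L2 n) {φ : Space n → ℝ} (hφ : Continuous φ)
    (hc : HasCompactSupport φ) :
    ∫ x, (f + f' : L2 n) x * φ x = (∫ x, f x * φ x) + ∫ x, f' x * φ x := by
  rw [← integral_add (integrable_mul_of_test f hφ hc) (integrable_mul_of_test f' hφ hc)]
  refine integral_congr_ae ?_
  filter_upwards [Lp.coeFn_add f f'] with x hx
  rw [hx, Pi.add_apply, add_mul]

theorem integral_smul_mul {n : ℕ} (c : ℝ) (f : L2 n) (φ : Space n → ℝ) :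
    ∫ x, (c • f : L2 n) x * φ x = c * ∫ x, f x * φ x := by
  rw [← integral_const_mul]
  refine integral_congr_ae ?_
  filter_upwards [Lp.coeFn_smul c f] with x hx
  rw [hx, Pi.smul_apply, smul_eq_mul, mul_assoc]

theorem HasWeakPartial.zero {n : ℕ} (i : Fin n) : HasWeakPartial i (0 : L2 n) 0 := by
  intro φ _ _
  have h : ∀ ψ : Space n → ℝ, ∫ x, (0 : L2 n) x * ψ x = 0 := fun ψ => by
    have h0 := integral_smul_mul 0 (0 : L2 n) ψ
    rwa [zero_smul, zero_mul] at h0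
  rw [h, h, neg_zero]

theorem HasWeakPartial.add {n : ℕ} {i : Fin n} {f g f' g' : L2 n}
    (h : HasWeakPartial i f g) (h' : HasWeakPartial i f' g') :
    HasWeakPartial i (f + f') (g + g') := by
  intro φ hφ hc
  rw [integral_add_mul f f' (continuous_partial i hφ) (hasCompactSupport_partial i hc),
    integral_add_mul g g' hφ.continuous hc, h φ hφ hc, h' φ hφ hc, neg_add]

theorem HasWeakPartial.smul {n : ℕ} {i : Fin n} {f g : L2 n} (c : ℝ)
    (h : HasWeakPartial i f g) : HasWeakPartial i (c • f) (c • g) := by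
  intro φ hφ hc
  rw [integral_smul_mul, integral_smul_mul, h φ hφ hc, mul_neg]

/-- Weak partial derivatives are unique. -/
theorem HasWeakPartial.unique {n : ℕ} {i : Fin n} {f g g' : L2 n}
    (h : HasWeakPartial i f g) (h' : HasWeakPartial i f g') : g = g' := by
  have hloc : ∀ k : L2 n, LocallyIntegrable k (volume : Measure (Space n)) := fun k =>
    (Lp.memLp k).locallyIntegrable (by norm_num)
  refine Lp.ext (ae_eq_of_integral_contDiff_smul_eq (hloc g) (hloc g') ?_)
  intro φ hφ hc
  have := (h φ hφ hc).symm.trans (h' φ hφ hc)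
  simpa [mul_comm] using this

/-- The Sobolev space `H²(ℝⁿ)`: the functions `f ∈ L²(ℝⁿ)` whose weak partial derivatives of
order one and two lie in `L²(ℝⁿ)`. An element is stored with its derivatives, as
`(f, (∂ᵢf)ᵢ, (∂ⱼ∂ᵢf)ᵢⱼ)`; these are determined by `f` (see `H2.toL2_injective`). The topology
is that of the usual `H²` norm: `L²` convergence of `f`, of all `∂ᵢf` and of all `∂ⱼ∂ᵢf`. -/
def H2 (n : ℕ) : Submodule ℝ (L2 n × (Fin n → L2 n) × (Fin n → Fin n → L2 n)) where
  carrier := {p | (∀ i, HasWeakPartial i p.1 (p.2.1 i)) ∧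
    ∀ i j, HasWeakPartial j (p.2.1 i) (p.2.2 i j)}
  zero_mem' := ⟨fun i => HasWeakPartial.zero i, fun _ j => HasWeakPartial.zero j⟩
  add_mem' := fun hp hq =>
    ⟨fun i => (hp.1 i).add (hq.1 i), fun i j => (hp.2 i j).add (hq.2 i j)⟩
  smul_mem' := fun c _ hp => ⟨fun i => (hp.1 i).smul c, fun i j => (hp.2 i j).smul c⟩

/-- The function `f ∈ L²(ℝⁿ)` underlying an element of `H²(ℝⁿ)`. -/
def H2.toL2 {n : ℕ} (f : H2 n) : L2 n := f.1.1

/-- The weak Laplacian `Δf = ∑ᵢ ∂ᵢ∂ᵢf ∈ L²(ℝⁿ)` of `f ∈ H²(ℝⁿ)`. -/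
def H2.laplacian {n : ℕ} (f : H2 n) : L2 n := ∑ i, f.1.2.2 i i

theorem H2.toL2_injective {n : ℕ} : Function.Injective (H2.toL2 (n := n)) := by
  rintro ⟨⟨f, g, h⟩, hp⟩ ⟨⟨f', g', h'⟩, hq⟩ hff
  obtain rfl : f = f' := hff
  obtain rfl : g = g' := funext fun i => (hp.1 i).unique (hq.1 i)
  obtain rfl : h = h' := funext fun i => funext fun j => (hp.2 i j).unique (hq.2 i j)
  rfl

/-- The support of (the class of) `f`: the complement of the largest open set on which `f`
vanishes almost everywhere. -/
def essSupp {n : ℕ} (f : L2 n) : Set (Space n) :=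
  (⋃₀ {U : Set (Space n) | IsOpen U ∧ ∀ᵐ x, x ∈ U → f x = 0})ᶜ

/-- The time derivative `u_t(t) ∈ L²(ℝⁿ)` for `t ∈ [0, ∞)` (one-sided at `t = 0`). -/
def timeDeriv {n : ℕ} (u : ℝ → H2 n) (t : ℝ) : L2 n :=
  derivWithin (fun s => H2.toL2 (u s)) (Ici 0) t

/-- `u ∈ C([0,∞); H²(ℝⁿ)) ∩ C¹([0,∞); L²(ℝⁿ))` is a weak solution of
`u_tt + Δ²u + V u = 0`, `u(0) = u₀`, `u_t(0) = u₁`: for every `φ ∈ H²(ℝⁿ)` and `t > 0`,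
`d/dt (u_t(t), φ) + (Δu(t), Δφ) + ∫ V u(t) φ = 0`. Only the values `u t` for `t ≥ 0` matter. -/
structure IsWeakSolution {n : ℕ} (V : Space n →ᵇ ℝ) (u₀ : H2 n) (u₁ : L2 n)
    (u : ℝ → H2 n) : Prop where
  continuousOn : ContinuousOn u (Ici 0)
  contDiffOn : ContDiffOn ℝ 1 (fun t => H2.toL2 (u t)) (Ici 0)
  init : u 0 = u₀
  init_deriv : timeDeriv u 0 = u₁
  weak : ∀ φ : H2 n, ∀ t : ℝ, 0 < t →
    HasDerivAt (fun s => inner ℝ (timeDeriv u s) (H2.toL2 φ))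
      (-(inner ℝ (H2.laplacian (u t)) (H2.laplacian φ) + ∫ x, V x * H2.toL2 (u t) x * H2.toL2 φ x)) t

end PlateEq

end

/-!
The equation reads `u_tt + (1 - Δ)² u = K u` with `K u = u - 2Δu - Vu` of order two only. For
`ψ = (1 - Δ) u + i u_t` this is the Schrödinger equation `ψ_t = -i (1 - Δ) ψ + i K (1 - Δ)⁻¹ Re ψ`
on complex `L²`, a bounded perturbation of the group `e^{-it(1-Δ)}`. Applying `(1 - Δ)⁻¹`, a
Fourier multiplier, keeps all time derivatives in `L²`.

For the estimate, integrate the equation in time: with `W = ∫₀ᵗ u`, testing `u_t + Δ²W + VW = u₁`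
with `u = W_t` gives `‖u‖² + ‖ΔW‖² + (VW, W) = ‖u₀‖² + 2 (u₁, W)`, and Young's inequality
`2 (u₁, W) ≤ ∫_Ω |u₁|² / V + (VW, W)` absorbs the potential term. For zero data the same identity
gives uniqueness.
-/

namespace PlateEq

open Filter Topology BoundedContinuousFunction
open scoped SchwartzMap FourierTransform LineDeriv

section LinearODE

variable {E F : Type*} [NormedAddCommGroup E] [NormedSpace ℝ E] [NormedAddCommGroup F]
  [NormedSpace ℝ F]

theorem continuous_apply_of_strongly_continuous {T : Type*} [TopologicalSpace T]
    {A : T → E →L[ℝ] F} {K : ℝ} (hA : ∀ x, Continuous fun t => A t x) (hK : ∀ t, ‖A t‖ ≤ K) :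
    Continuous fun p : T × E => A p.1 p.2 :=
  continuous_prod_of_continuous_lipschitzWith' _ K.toNNReal
    (fun t => (A t).lipschitz.weaken (NNReal.le_toNNReal_of_coe_le (hK t))) hA

theorem hasDerivAt_strong_apply {R : ℝ → E →L[ℝ] F} {K : ℝ} (hK : ∀ t, ‖R t‖ ≤ K)
    {y : ℝ → E} {y' : E} {r : F} {t : ℝ} (hR : HasDerivAt (fun s => R s (y t)) r t)
    (hc : ContinuousAt (fun s => R s y') t) (hy : HasDerivAt y y' t) :
    HasDerivAt (fun s => R s (y s)) (r + R t y') t := by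
  have h_linear : HasDerivAt (fun s => (s - t) • R s y') (R t y') t := by
    rw [hasDerivAt_iff_tendsto_slope]
    refine (hc.tendsto.mono_left nhdsWithin_le_nhds).congr' ?_
    filter_upwards [self_mem_nhdsWithin] with s hs
    have : s - t ≠ 0 := sub_ne_zero.2 hs
    simp [slope_def_module, smul_smul, this]
  have h_remainder : HasDerivAt (fun s => R s (y s - y t - (s - t) • y')) 0 t := by
    rw [hasDerivAt_iff_isLittleO]
    refine Asymptotics.IsBigO.trans_isLittleO ?_ (hasDerivAt_iff_isLittleO.1 hy)
    refine Asymptotics.IsBigO.of_bound K (Eventually.of_forall fun s => ?_)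
    simpa using (R s).le_of_opNorm_le (hK s) (y s - y t - (s - t) • y')
  convert! (hR.add h_linear).add h_remainder using 1
  · ext s
    simp
  · simp

theorem norm_integral_le_cosh {f : ℝ → E} {C L : ℝ} (hL : 0 < L)
    (hf : ∀ s, ‖f s‖ ≤ C * Real.cosh (L * s)) (t : ℝ) :
    ‖∫ s in (0 : ℝ)..t, f s‖ ≤ C / L * Real.cosh (L * t) := by
  have hC : 0 ≤ C := by simpa using (norm_nonneg _).trans (hf 0)
  have h_primitive : ∫ s in (0 : ℝ)..t, C * Real.cosh (L * s) = C / L * Real.sinh (L * t) := by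
    have h_deriv (s : ℝ) (_ : s ∈ uIcc 0 t) : HasDerivAt (fun s => C / L * Real.sinh (L * s))
        (C * Real.cosh (L * s)) s := by
      convert! (((hasDerivAt_id s).const_mul L).sinh.const_mul (C / L)) using 1
      simp only [id_eq, mul_one]
      field_simp
    rw [intervalIntegral.integral_eq_sub_of_hasDerivAt h_deriv
      (Continuous.intervalIntegrable (by fun_prop) _ _)]
    simp
  calc ‖∫ s in (0 : ℝ)..t, f s‖ ≤ |∫ s in (0 : ℝ)..t, C * Real.cosh (L * s)| :=
        intervalIntegral.norm_integral_le_abs_of_norm_le (Eventually.of_forall hf)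
          (Continuous.intervalIntegrable (by fun_prop) _ _)
    _ = C / L * |Real.sinh (L * t)| := by
        rw [h_primitive, abs_mul, abs_of_nonneg (div_nonneg hC hL.le)]
    _ ≤ C / L * Real.cosh (L * t) := by
        rw [Real.abs_sinh, ← Real.cosh_abs (L * t)]
        gcongr
        exact (Real.sinh_lt_cosh _).le

theorem exists_weighted_volterra [CompleteSpace E] {A : ℝ → E →L[ℝ] E} {K L : ℝ}
    (hA : ∀ x, Continuous fun t => A t x) (hK : ∀ t, ‖A t‖ ≤ K) (hL : 0 < L) :
    ∃ J : (ℝ →ᵇ E) →L[ℝ] (ℝ →ᵇ E), ‖J‖ ≤ K / L ∧ ∀ z t,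
      Real.cosh (L * t) • J z t = ∫ s in (0 : ℝ)..t, A s (Real.cosh (L * s) • z s) := by
  have h_cont (z : ℝ →ᵇ E) : Continuous fun s => A s (Real.cosh (L * s) • z s) :=
    (continuous_apply_of_strongly_continuous hA hK).comp
      (continuous_id.prodMk (Continuous.smul (by fun_prop) z.continuous))
  have h_bound (z : ℝ →ᵇ E) (s : ℝ) :
      ‖A s (Real.cosh (L * s) • z s)‖ ≤ K * ‖z‖ * Real.cosh (L * s) := by
    refine ((A s).le_of_opNorm_le (hK s) _).trans ?_
    rw [norm_smul, Real.norm_of_nonneg (Real.cosh_pos _).le, mul_assoc, mul_comm ‖z‖]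
    have := (norm_nonneg _).trans (hK 0)
    gcongr
    exact z.norm_coe_le_norm s
  have h_quotient_cont (z : ℝ →ᵇ E) : Continuous fun t => (Real.cosh (L * t))⁻¹ •
      ∫ s in (0 : ℝ)..t, A s (Real.cosh (L * s) • z s) :=
    (Continuous.inv₀ (by fun_prop) fun t => (Real.cosh_pos _).ne').smul
      (continuous_iff_continuousAt.2 fun t =>
        ((h_cont z).integral_hasStrictDerivAt 0 t).hasDerivAt.continuousAt)
  have h_norm (z : ℝ →ᵇ E) (t : ℝ) : ‖(Real.cosh (L * t))⁻¹ •
      ∫ s in (0 : ℝ)..t, A s (Real.cosh (L * s) • z s)‖ ≤ K / L * ‖z‖ := by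
    rw [norm_smul, norm_inv, Real.norm_of_nonneg (Real.cosh_pos _).le,
      inv_mul_le_iff₀ (Real.cosh_pos _)]
    exact (norm_integral_le_cosh hL (h_bound z) t).trans_eq (by ring)
  refine ⟨LinearMap.mkContinuous
    { toFun := fun z => ofNormedAddCommGroup _ (h_quotient_cont z) _ (h_norm z)
      map_add' := fun z z' => by
        ext t
        simp only [coe_ofNormedAddCommGroup, coe_add, Pi.add_apply, smul_add, map_add]
        rw [intervalIntegral.integral_add ((h_cont z).intervalIntegrable _ _)
          ((h_cont z').intervalIntegrable _ _), smul_add]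
      map_smul' := fun c z => by
        ext t
        simp [smul_comm _ c] } (K / L) fun z => ?_, ?_, fun z t => ?_⟩
  · exact (norm_le (by have := (norm_nonneg _).trans (hK 0); positivity)).2 (h_norm z)
  · exact LinearMap.mkContinuous_norm_le _
      (div_nonneg ((norm_nonneg _).trans (hK 0)) hL.le) _
  · simp [smul_smul, (Real.cosh_pos (L * t)).ne']

/-- The equation for `y(t) / cosh (L t)` has the form `z = z₀ + J z` with `‖J‖ ≤ K / L < 1`. -/
theorem exists_solution_linear_ode [CompleteSpace E] {A : ℝ → E →L[ℝ] E} {K : ℝ}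
    (hA : ∀ x, Continuous fun t => A t x) (hK : ∀ t, ‖A t‖ ≤ K) (y₀ : E) :
    ∃ y : ℝ → E, y 0 = y₀ ∧ ∀ t, HasDerivAt y (A t (y t)) t := by
  have hK0 : 0 ≤ K := (norm_nonneg _).trans (hK 0)
  have hL : 0 < K + 1 := by positivity
  obtain ⟨J, hJ, hJ_apply⟩ := exists_weighted_volterra hA hK hL
  have hJ_lt : ‖J‖ < 1 := hJ.trans_lt ((div_lt_one hL).2 (lt_add_one K))
  let z₀ : ℝ →ᵇ E := ofNormedAddCommGroup (fun t => (Real.cosh ((K + 1) * t))⁻¹ • y₀)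
    ((Continuous.inv₀ (by fun_prop) fun t => (Real.cosh_pos _).ne').smul continuous_const) ‖y₀‖
    fun t => by
      rw [norm_smul, norm_inv, Real.norm_of_nonneg (Real.cosh_pos _).le]
      exact mul_le_of_le_one_left (norm_nonneg _) (inv_le_one_of_one_le₀ (Real.one_le_cosh _))
  obtain ⟨z, hz⟩ : ∃ z, z = z₀ + J z := by
    obtain ⟨S, hS⟩ := (isUnit_one_sub_of_norm_lt_one hJ_lt).exists_right_inv
    refine ⟨S z₀, sub_eq_iff_eq_add.1 ?_⟩
    simpa using DFunLike.congr_fun hS z₀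
  set y : ℝ → E := fun t => Real.cosh ((K + 1) * t) • z t with hy_def
  have hy (t : ℝ) : y t = y₀ + ∫ s in (0 : ℝ)..t, A s (y s) := by
    rw [← hJ_apply, hy_def]
    conv_lhs => rw [hz]
    simp [z₀, smul_smul, (Real.cosh_pos _).ne']
  have h_cont : Continuous fun s => A s (y s) :=
    (continuous_apply_of_strongly_continuous hA hK).comp
      (continuous_id.prodMk (Continuous.smul (by fun_prop) z.continuous))
  refine ⟨y, by simp [hy 0], fun t => ?_⟩
  exact ((h_cont.integral_hasStrictDerivAt 0 t).hasDerivAt.const_add y₀).congr_of_eventuallyEq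
    (Eventually.of_forall hy)

/-- In the interaction picture `y = U(-t) z` the perturbation becomes the bounded equation
`y' = U(-t) B U(t) y`. -/
theorem exists_perturbed_group_orbit [CompleteSpace E] {U : ℝ → E →L[ℝ] E} {M A : E →L[ℝ] F}
    (hU : ∀ x, Continuous fun t => U t x) (hU_norm : ∀ t, ‖U t‖ ≤ 1) (hU_zero : U 0 = 1)
    (hU_neg : ∀ t, U t * U (-t) = 1)
    (hM : ∀ x t, HasDerivAt (fun s => M (U s x)) (A (U t x)) t) (B : E →L[ℝ] E) (z₀ : E) :
    ∃ z : ℝ → E, Continuous z ∧ z 0 = z₀ ∧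
      ∀ t, HasDerivAt (fun s => M (z s)) (A (z t) + M (B (z t))) t := by
  have hU_joint := continuous_apply_of_strongly_continuous hU hU_norm
  have h_cont (x : E) : Continuous fun t => (U (-t) * B * U t) x :=
    hU_joint.comp (continuous_neg.prodMk (B.continuous.comp (hU x)))
  have h_norm (t : ℝ) : ‖U (-t) * B * U t‖ ≤ 1 * ‖B‖ * 1 :=
    (norm_mul₃_le).trans (by gcongr <;> exact hU_norm _)
  obtain ⟨y, hy_zero, hy⟩ := exists_solution_linear_ode h_cont h_norm z₀
  have hy_cont : Continuous y := continuous_iff_continuousAt.2 fun t => (hy t).continuousAt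
  refine ⟨fun t => U t (y t), hU_joint.comp (continuous_id.prodMk hy_cont), ?_, fun t => ?_⟩
  · simp [hy_zero, hU_zero]
  have h_cancel (x : E) : U t (U (-t) x) = x := DFunLike.congr_fun (hU_neg t) x
  have h_deriv := hasDerivAt_strong_apply (R := fun s => M ∘L U s) (K := ‖M‖ * 1)
    (fun s => (M.opNorm_comp_le _).trans (by gcongr; exact hU_norm s)) (hM (y t) t)
    (M.continuous.comp (hU _)).continuousAt (hy t)
  simpa [h_cancel] using h_deriv

end LinearODE

section Multiplication

variable {X : Type*} [TopologicalSpace X] [MeasurableSpace X] [BorelSpace X]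
  {μ : Measure X} {𝕜 : Type*} [RCLike 𝕜]

/-- Multiplication by a bounded continuous function, as a bounded operator on `L²`. -/
noncomputable def mulCLM (μ : Measure X) (f : X →ᵇ 𝕜) : Lp 𝕜 2 μ →L[𝕜] Lp 𝕜 2 μ :=
  (ContinuousLinearMap.mul 𝕜 𝕜).holderL μ ⊤ 2 2 (memLp_top f).toLp

theorem coeFn_mulCLM (f : X →ᵇ 𝕜) (g : Lp 𝕜 2 μ) : mulCLM μ f g =ᵐ[μ] fun x => f x * g x := by
  filter_upwards [(ContinuousLinearMap.mul 𝕜 𝕜).coeFn_holder (r := 2)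
    ((memLp_top (μ := μ) f).toLp) g, (memLp_top (μ := μ) f).coeFn_toLp] with x hx hf
  rw [← hf]
  exact hx

theorem mulCLM_eq_of_ae {f : X →ᵇ 𝕜} {g h : Lp 𝕜 2 μ} (hfg : ∀ᵐ x ∂μ, f x * g x = h x) :
    mulCLM μ f g = h :=
  Lp.ext ((coeFn_mulCLM f g).trans hfg)

theorem mulCLM_add (f g : X →ᵇ 𝕜) : mulCLM μ (f + g) = mulCLM μ f + mulCLM μ g := by
  ext1 h
  refine mulCLM_eq_of_ae ?_
  filter_upwards [Lp.coeFn_add (mulCLM μ f h) (mulCLM μ g h), coeFn_mulCLM f h,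
    coeFn_mulCLM g h] with x hx hf hg
  rw [_root_.add_apply (mulCLM μ f), hx, Pi.add_apply, hf, hg, coe_add, Pi.add_apply, add_mul]

theorem mulCLM_mul (f g : X →ᵇ 𝕜) : mulCLM μ (f * g) = mulCLM μ f * mulCLM μ g := by
  ext1 h
  refine mulCLM_eq_of_ae ?_
  filter_upwards [coeFn_mulCLM f (mulCLM μ g h), coeFn_mulCLM g h] with x hf hg
  rw [mul_apply_eq_comp, hf, hg, coe_mul, Pi.mul_apply, mul_assoc]

theorem mulCLM_algebraMap (c : 𝕜) :
    mulCLM μ (algebraMap 𝕜 (X →ᵇ 𝕜) c) = algebraMap 𝕜 (Lp 𝕜 2 μ →L[𝕜] Lp 𝕜 2 μ) c := by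
  ext1 h
  refine mulCLM_eq_of_ae ?_
  filter_upwards [Lp.coeFn_smul c h] with x hx
  simp [Algebra.algebraMap_eq_smul_one, hx]

theorem mulCLM_star (f : X →ᵇ 𝕜) : mulCLM μ (star f) = star (mulCLM μ f) := by
  refine (ContinuousLinearMap.eq_adjoint_iff _ _).2 fun g h => ?_
  rw [L2.inner_def, L2.inner_def]
  refine integral_congr_ae ?_
  filter_upwards [coeFn_mulCLM (star f) g, coeFn_mulCLM f h] with x hx hx'
  rw [hx, hx']
  simp only [RCLike.inner_apply, star_apply, map_mul, RCLike.star_def, RCLike.conj_conj]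
  ring

/-- The representation of bounded continuous functions by multiplication operators on `L²`. -/
noncomputable def mulOp (μ : Measure X) : (X →ᵇ 𝕜) →⋆ₐ[𝕜] (Lp 𝕜 2 μ →L[𝕜] Lp 𝕜 2 μ) where
  toFun := mulCLM μ
  map_one' := by simpa using mulCLM_algebraMap (μ := μ) (X := X) (1 : 𝕜)
  map_mul' := mulCLM_mul
  map_zero' := by simpa using mulCLM_algebraMap (μ := μ) (X := X) (0 : 𝕜)
  map_add' := mulCLM_add
  commutes' := mulCLM_algebraMap
  map_star' := mulCLM_star

theorem coeFn_mulOp (f : X →ᵇ 𝕜) (g : Lp 𝕜 2 μ) : mulOp μ f g =ᵐ[μ] fun x => f x * g x :=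
  coeFn_mulCLM f g

theorem inner_mulOp (f : X →ᵇ ℝ) (g h : Lp ℝ 2 μ) :
    inner ℝ (mulOp μ f g) h = ∫ x, f x * g x * h x ∂μ := by
  rw [L2.inner_def]
  refine integral_congr_ae ?_
  filter_upwards [coeFn_mulOp f g] with x hx
  simp [hx, mul_comm]

theorem inner_mulOp_comm (f : X →ᵇ ℝ) (g h : Lp ℝ 2 μ) :
    inner ℝ (mulOp μ f g) h = inner ℝ (mulOp μ f h) g := by
  simp only [inner_mulOp, mul_right_comm]

theorem norm_sq_mulOp (f : X →ᵇ 𝕜) (ψ : Lp 𝕜 2 μ) :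
    ‖mulOp μ f ψ‖ ^ 2 = ∫ x, ‖f x‖ ^ 2 * ‖ψ x‖ ^ 2 ∂μ := by
  have h_inner : ((‖mulOp μ f ψ‖ ^ 2 : ℝ) : 𝕜) = ∫ x, ((‖f x‖ ^ 2 * ‖ψ x‖ ^ 2 : ℝ) : 𝕜) ∂μ := by
    rw [RCLike.ofReal_pow, ← inner_self_eq_norm_sq_to_K, L2.inner_def]
    refine integral_congr_ae ?_
    filter_upwards [coeFn_mulOp f ψ] with x hx
    rw [inner_self_eq_norm_sq_to_K, hx, norm_mul, ← mul_pow, RCLike.ofReal_pow]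
  exact RCLike.ofReal_injective (h_inner.trans integral_ofReal)

theorem tendsto_mulOp {ι : Type*} {l : Filter ι} [l.IsCountablyGenerated] {m : ι → X →ᵇ 𝕜}
    {m₀ : X →ᵇ 𝕜} {C : ℝ} (hC : ∀ s x, ‖m s x‖ ≤ C)
    (hm : ∀ x, Tendsto (fun s => m s x) l (𝓝 (m₀ x))) (ψ : Lp 𝕜 2 μ) :
    Tendsto (fun s => mulOp μ (m s) ψ) l (𝓝 (mulOp μ m₀ ψ)) := by
  have hψ : Integrable (fun x => ‖ψ x‖ ^ 2) μ := (Lp.memLp ψ).integrable_norm_pow two_ne_zero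
  have h_integral : Tendsto (fun s => ∫ x, ‖(m s - m₀) x‖ ^ 2 * ‖ψ x‖ ^ 2 ∂μ) l
      (𝓝 (∫ _, (0 : ℝ) ∂μ)) := by
    refine tendsto_integral_filter_of_dominated_convergence
      (fun x => (C + ‖m₀‖) ^ 2 * ‖ψ x‖ ^ 2) (Eventually.of_forall fun s => ?_)
      (Eventually.of_forall fun s => Eventually.of_forall fun x => ?_) (hψ.const_mul _)
      (Eventually.of_forall fun x => ?_)
    · exact ((m s - m₀).continuous.norm.pow 2).aestronglyMeasurable.mul hψ.aestronglyMeasurable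
    · rw [Real.norm_of_nonneg (by positivity)]
      gcongr
      exact (norm_sub_le _ _).trans (add_le_add (hC s x) (m₀.norm_coe_le_norm x))
    · simpa using (((hm x).sub_const (m₀ x)).norm.pow 2).mul_const (‖ψ x‖ ^ 2)
  rw [tendsto_iff_norm_sub_tendsto_zero]
  have h_sqrt := (Real.continuous_sqrt.tendsto _).comp h_integral
  rw [integral_zero, Real.sqrt_zero] at h_sqrt
  refine h_sqrt.congr fun s => ?_
  rw [Function.comp_apply, ← norm_sq_mulOp, Real.sqrt_sq (norm_nonneg _), map_sub,
    _root_.sub_apply]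

theorem hasDerivAt_mulOp {m : ℝ → X →ᵇ 𝕜} {m' : X →ᵇ 𝕜} {C t : ℝ}
    (hLip : ∀ s x, ‖m s x - m t x‖ ≤ C * |s - t|)
    (hm : ∀ x, HasDerivAt (fun s => m s x) (m' x) t) (ψ : Lp 𝕜 2 μ) :
    HasDerivAt (fun s => mulOp μ (m s) ψ) (mulOp μ m' ψ) t := by
  have h_slope (s : ℝ) (x : X) :
      (((s - t)⁻¹ : ℝ) : 𝕜) * (m s x - m t x) = slope (fun s => m s x) t s := by
    rw [slope_def_module, RCLike.real_smul_eq_coe_mul]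
  have h_tendsto : Tendsto (fun s => mulOp μ ((((s - t)⁻¹ : ℝ) : 𝕜) • (m s - m t)) ψ) (𝓝[≠] t)
      (𝓝 (mulOp μ m' ψ)) := by
    refine tendsto_mulOp (C := C) (fun s x => ?_) (fun x => ?_) ψ
    · simp only [coe_smul, coe_sub, Pi.sub_apply, smul_eq_mul]
      rw [norm_mul, RCLike.norm_ofReal, abs_inv]
      have hC : 0 ≤ C := by simpa using (norm_nonneg _).trans (hLip (t + 1) x)
      exact inv_mul_le_of_le_mul₀ (abs_nonneg _) hC ((hLip s x).trans_eq (mul_comm _ _))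
    · exact (hasDerivAt_iff_tendsto_slope.1 (hm x)).congr fun s => (h_slope s x).symm
  refine hasDerivAt_iff_tendsto_slope.2 (h_tendsto.congr fun s => ?_)
  rw [slope_def_module, map_smul, map_sub, ← RCLike.real_smul_eq_coe_smul (K := 𝕜)]
  rfl

end Multiplication

section Truncation

theorem exists_cutoff_sequence {E : Type*} [NormedAddCommGroup E] [NormedSpace ℝ E]
    [FiniteDimensional ℝ E] [HasContDiffBump E] (e : E) :
    ∃ (η : ℕ → E → ℝ) (C : ℝ), (∀ k, ContDiff ℝ ∞ (η k)) ∧ (∀ k, HasCompactSupport (η k)) ∧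
      (∀ k x, ‖η k x‖ ≤ 1) ∧ (∀ x, Tendsto (fun k => η k x) atTop (𝓝 1)) ∧
      ∀ k x, ‖fderiv ℝ (η k) x e‖ ≤ 1 / ((k : ℝ) + 1) * C := by
  let χ : ContDiffBump (0 : E) := ⟨1, 2, one_pos, one_lt_two⟩
  have h_smooth : ContDiff ℝ ∞ χ := χ.contDiff
  obtain ⟨C, hC⟩ := ((h_smooth.continuous_fderiv (by simp)).clm_apply continuous_const)
    |>.bounded_above_of_compact_support (χ.hasCompactSupport.fderiv_apply ℝ e)
  have hr : ∀ k : ℕ, 0 < 1 / ((k : ℝ) + 1) := fun k => by positivity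
  refine ⟨fun k x => χ ((1 / ((k : ℝ) + 1)) • x), C, fun k => h_smooth.comp (contDiff_const_smul _),
    fun k => χ.hasCompactSupport.comp_smul (hr k).ne', fun k x => ?_, fun x => ?_, fun k x => ?_⟩
  · rw [Real.norm_of_nonneg χ.nonneg]
    exact χ.le_one
  · have h_scale : Tendsto (fun k : ℕ => (1 / ((k : ℝ) + 1)) • x) atTop (𝓝 0) := by
      simpa using (tendsto_one_div_add_atTop_nhds_zero_nat (𝕜 := ℝ)).smul_const x
    have h_tendsto := (χ.continuous.tendsto 0).comp h_scale
    rwa [χ.one_of_mem_closedBall (by simp [χ])] at h_tendsto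
  · have h_deriv := (h_smooth.differentiable (by simp) _).hasFDerivAt.comp x
      ((hasFDerivAt_id x).const_smul (1 / ((k : ℝ) + 1)))
    rw [show fderiv ℝ (fun x => χ ((1 / ((k : ℝ) + 1)) • x)) x = _ from h_deriv.fderiv]
    simp only [ContinuousLinearMap.coe_comp, Function.comp_apply, _root_.smul_apply,
      ContinuousLinearMap.id_apply, map_smul, norm_smul, Real.norm_of_nonneg (hr k).le]
    exact mul_le_mul_of_nonneg_left (hC _) (hr k).le

theorem exists_cutoff_mulOp {E : Type*} [NormedAddCommGroup E] [NormedSpace ℝ E]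
    [FiniteDimensional ℝ E] [HasContDiffBump E] [MeasurableSpace E] [BorelSpace E]
    (μ : Measure E) (e : E) :
    ∃ X X' : ℕ → E →ᵇ ℝ, (∀ k, ContDiff ℝ ∞ (X k)) ∧ (∀ k, HasCompactSupport (X k)) ∧
      (∀ k x, X' k x = fderiv ℝ (X k) x e) ∧
      ∀ p : Lp ℝ 2 μ, Tendsto (fun k => mulOp μ (X k) p) atTop (𝓝 p) ∧
        Tendsto (fun k => mulOp μ (X' k) p) atTop (𝓝 0) := by
  obtain ⟨η, C, hη, hη_supp, hη_le, hη_tendsto, hη'_le⟩ := exists_cutoff_sequence e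
  have hη'_le_one (k : ℕ) (x : E) : ‖fderiv ℝ (η k) x e‖ ≤ 1 * C := by
    have hC : 0 ≤ C := by simpa using (norm_nonneg _).trans (hη'_le 0 x)
    refine (hη'_le k x).trans ?_
    gcongr
    exact div_le_one_of_le₀ (by simp) (by positivity)
  let X (k : ℕ) : E →ᵇ ℝ := ofNormedAddCommGroup (η k) (hη k).continuous 1 (hη_le k)
  let X' (k : ℕ) : E →ᵇ ℝ := ofNormedAddCommGroup (fun x => fderiv ℝ (η k) x e)
    (((hη k).continuous_fderiv (by simp)).clm_apply continuous_const) (1 * C) (hη'_le_one k)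
  have hX'_tendsto (x : E) : Tendsto (fun k => X' k x) atTop (𝓝 0) :=
    squeeze_zero_norm (fun k => hη'_le k x)
      (by simpa using tendsto_one_div_add_atTop_nhds_zero_nat.mul_const C)
  refine ⟨X, X', hη, hη_supp, fun k x => rfl, fun p => ⟨?_, ?_⟩⟩
  · simpa using tendsto_mulOp (m := X) (m₀ := 1) hη_le hη_tendsto p
  · simpa using tendsto_mulOp (m := X') (m₀ := 0) hη'_le_one hX'_tendsto p

variable {n : ℕ}

theorem integral_mul_eq_inner (f : L2 n) {φ : Space n → ℝ} {p : L2 n} (hp : p =ᵐ[volume] φ) :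
    ∫ x, f x * φ x = inner ℝ f p := by
  rw [L2.inner_def]
  refine integral_congr_ae ?_
  filter_upwards [hp] with x hx
  simp [hx, mul_comm]

theorem HasWeakPartial.integral_eq {i : Fin n} {f g : L2 n} (h : HasWeakPartial i f g)
    {ψ : Space n → ℝ} (hψ : ContDiff ℝ ∞ ψ) (hψ_memLp : MemLp ψ 2)
    (hψ'_memLp : MemLp (fun x => fderiv ℝ ψ x (EuclideanSpace.single i 1)) 2) :
    ∫ x, f x * fderiv ℝ ψ x (EuclideanSpace.single i 1) = - ∫ x, g x * ψ x := by
  obtain ⟨X, X', hX, hX_supp, hX', h_tendsto⟩ :=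
    exists_cutoff_mulOp volume (EuclideanSpace.single i 1 : Space n)
  have h_test (k : ℕ) : inner ℝ f (mulOp volume (X k) hψ'_memLp.toLp
      + mulOp volume (X' k) hψ_memLp.toLp) = -inner ℝ g (mulOp volume (X k) hψ_memLp.toLp) := by
    rw [← integral_mul_eq_inner f (φ := fun x => fderiv ℝ (fun x => X k x * ψ x) x
      (EuclideanSpace.single i 1)), ← integral_mul_eq_inner g (φ := fun x => X k x * ψ x)]
    · exact h _ ((hX k).mul hψ) (hX_supp k).mul_right
    · filter_upwards [coeFn_mulOp (X k) hψ_memLp.toLp, hψ_memLp.coeFn_toLp] with x hx hψx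
      rw [hx, hψx]
    · filter_upwards [Lp.coeFn_add (mulOp volume (X k) hψ'_memLp.toLp)
        (mulOp volume (X' k) hψ_memLp.toLp), coeFn_mulOp (X k) hψ'_memLp.toLp,
        coeFn_mulOp (X' k) hψ_memLp.toLp, hψ_memLp.coeFn_toLp, hψ'_memLp.coeFn_toLp]
        with x h_add h_mul h_mul' hψx hψ'x
      rw [h_add, Pi.add_apply, h_mul, h_mul', hψx, hψ'x, fderiv_fun_mul
        ((hX k).differentiable (by simp) x) (hψ.differentiable (by simp) x)]
      simp [hX', mul_comm]
  rw [integral_mul_eq_inner f hψ'_memLp.coeFn_toLp, integral_mul_eq_inner g hψ_memLp.coeFn_toLp]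
  refine tendsto_nhds_unique ?_ ((tendsto_const_nhds.inner (h_tendsto _).1).neg.congr fun k =>
    (h_test k).symm)
  simpa using tendsto_const_nhds.inner
    ((h_tendsto hψ'_memLp.toLp).1.add (h_tendsto hψ_memLp.toLp).2)

end Truncation

section Complexification

variable {X : Type*} [MeasurableSpace X] {μ : Measure X}

/-- The inclusion of real-valued into complex-valued `L²` functions. -/
noncomputable def toC : (X →₂[μ] ℝ) →L[ℝ] (X →₂[μ] ℂ) :=
  Complex.ofRealCLM.compLpL 2 μ

/-- The real part of a complex-valued `L²` function. -/
noncomputable def reL : (X →₂[μ] ℂ) →L[ℝ] (X →₂[μ] ℝ) :=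
  Complex.reCLM.compLpL 2 μ

theorem coeFn_toC (f : X →₂[μ] ℝ) : toC f =ᵐ[μ] fun x => (f x : ℂ) :=
  Complex.ofRealCLM.coeFn_compLpL f

theorem coeFn_reL (f : X →₂[μ] ℂ) : reL f =ᵐ[μ] fun x => (f x).re :=
  Complex.reCLM.coeFn_compLpL f

theorem reL_toC (f : X →₂[μ] ℝ) : reL (toC f) = f := by
  refine Lp.ext ?_
  filter_upwards [coeFn_reL (toC f), coeFn_toC f] with x hx_re hx
  rw [hx_re, hx, Complex.ofReal_re]

theorem reL_I_smul_toC (f : X →₂[μ] ℝ) : reL (Complex.I • toC f) = 0 := by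
  refine Lp.ext ?_
  filter_upwards [coeFn_reL (Complex.I • toC f), Lp.coeFn_smul Complex.I (toC f), coeFn_toC f,
    Lp.coeFn_zero ℝ 2 μ] with x hx_re hx_smul hx hx_zero
  rw [hx_re, hx_smul, hx_zero, Pi.smul_apply, hx]
  simp

theorem inner_reL (f : X →₂[μ] ℂ) (g : X →₂[μ] ℝ) :
    inner ℝ (reL f) g = (inner ℂ (toC g) f).re := by
  rw [L2.inner_def, L2.inner_def]
  refine (integral_congr_ae ?_).trans (integral_re (L2.integrable_inner (𝕜 := ℂ) (toC g) f))
  filter_upwards [coeFn_reL f, coeFn_toC g] with x hx_re hx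
  rw [hx_re, hx]
  simp [mul_comm]

theorem clm_integral_toC_mul (L : ℂ →L[ℝ] ℝ) (f : X →₂[μ] ℝ) {u : X → ℂ} (hu : MemLp u 2 μ) :
    L (∫ x, toC f x * u x ∂μ) = ∫ x, f x * L (u x) ∂μ := by
  refine (L.integral_comp_comm ((Lp.memLp (toC f)).integrable_mul (q := 2) hu)).symm.trans
    (integral_congr_ae ?_)
  filter_upwards [coeFn_toC f] with x hx
  rw [Pi.mul_apply, hx, ← Complex.real_smul, map_smul, smul_eq_mul]

theorem re_integral_mul_ofReal (f : X →₂[μ] ℂ) {v : X → ℝ} (hv : MemLp v 2 μ) :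
    (∫ x, f x * (v x : ℂ) ∂μ).re = ∫ x, reL f x * v x ∂μ := by
  refine (integral_re ((Lp.memLp f).integrable_mul (q := 2) hv.ofReal)).symm.trans
    (integral_congr_ae ?_)
  filter_upwards [coeFn_reL f] with x hx
  simp [hx]

end Complexification

section WeakDerivative

theorem lineDeriv_toTemperedDistribution_eq_iff {E : Type*} [NormedAddCommGroup E]
    [InnerProductSpace ℝ E] [FiniteDimensional ℝ E] [MeasurableSpace E] [BorelSpace E]
    {f g : E →₂[volume] ℂ} {e : E} :
    ∂_{e} (f : 𝓢'(E, ℂ)) = (g : 𝓢'(E, ℂ)) ↔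
      ∀ u : 𝓢(E, ℂ), ∫ x, f x * fderiv ℝ u x e = - ∫ x, g x * u x := by
  refine DFunLike.ext_iff.trans (forall_congr' fun u => ?_)
  rw [TemperedDistribution.lineDerivOp_apply_apply, map_neg, Lp.toTemperedDistribution_apply,
    Lp.toTemperedDistribution_apply, neg_eq_iff_eq_neg]
  simp only [smul_eq_mul, mul_comm _ (f _), mul_comm _ (g _),
    SchwartzMap.lineDerivOp_apply_eq_fderiv]

variable {n : ℕ}

theorem memLp_fderiv_schwartz (u : 𝓢(Space n, ℂ)) (e : Space n) :
    MemLp (fun x => fderiv ℝ u x e) 2 :=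
  ((∂_{e} u).memLp 2).ae_eq
    (Eventually.of_forall fun x => SchwartzMap.lineDerivOp_apply_eq_fderiv e u x)

theorem HasWeakPartial.integral_clm_schwartz {i : Fin n} {f g : L2 n} (h : HasWeakPartial i f g)
    (L : ℂ →L[ℝ] ℝ) (u : 𝓢(Space n, ℂ)) :
    ∫ x, f x * L (fderiv ℝ u x (EuclideanSpace.single i 1)) = - ∫ x, g x * L (u x) := by
  have h_fderiv (x : Space n) : fderiv ℝ (fun x => L (u x)) x (EuclideanSpace.single i 1)
      = L (fderiv ℝ u x (EuclideanSpace.single i 1)) := by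
    rw [show fderiv ℝ (fun x => L (u x)) x = L ∘L fderiv ℝ u x from
      (L.hasFDerivAt.comp x (u.differentiableAt (x := x)).hasFDerivAt).fderiv]
    rfl
  simp only [← h_fderiv]
  refine h.integral_eq (L.contDiff.comp (u.smooth ⊤)) (L.comp_memLp' (u.memLp 2)) ?_
  simpa only [h_fderiv] using! L.comp_memLp' (memLp_fderiv_schwartz u _)

theorem HasWeakPartial.lineDeriv_toC {i : Fin n} {f g : L2 n} (h : HasWeakPartial i f g) :
    ∂_{EuclideanSpace.single i (1 : ℝ)} (toC f : 𝓢'(Space n, ℂ)) = (toC g : 𝓢'(Space n, ℂ)) := by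
  refine lineDeriv_toTemperedDistribution_eq_iff.2 fun u => ?_
  have h_clm (L : ℂ →L[ℝ] ℝ) :
      L (∫ x, toC f x * fderiv ℝ u x (EuclideanSpace.single i 1)) = L (-∫ x, toC g x * u x) := by
    rw [map_neg, clm_integral_toC_mul L f (memLp_fderiv_schwartz u _),
      clm_integral_toC_mul L g (u.memLp 2), h.integral_clm_schwartz L u]
  exact Complex.ext (h_clm Complex.reCLM) (h_clm Complex.imCLM)

theorem hasWeakPartial_reL {i : Fin n} {f g : Space n →₂[volume] ℂ}
    (h : ∂_{EuclideanSpace.single i (1 : ℝ)} (f : 𝓢'(Space n, ℂ)) = (g : 𝓢'(Space n, ℂ))) :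
    HasWeakPartial i (reL f) (reL g) := by
  intro φ hφ hφ_supp
  have hφC_supp : HasCompactSupport (Complex.ofRealCLM ∘ φ) := hφ_supp.comp_left rfl
  have hφC : ContDiff ℝ ∞ (Complex.ofRealCLM ∘ φ) := by fun_prop
  have h_fderiv (x : Space n) :
      fderiv ℝ (hφC_supp.toSchwartzMap hφC) x (EuclideanSpace.single i 1)
        = ((fderiv ℝ φ x (EuclideanSpace.single i 1) : ℝ) : ℂ) := by
    rw [show fderiv ℝ (hφC_supp.toSchwartzMap hφC) x = Complex.ofRealCLM ∘L fderiv ℝ φ x from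
      (Complex.ofRealCLM.hasFDerivAt.comp x (hφ.differentiable (by simp) x).hasFDerivAt).fderiv]
    rfl
  have h_test := lineDeriv_toTemperedDistribution_eq_iff.1 h (hφC_supp.toSchwartzMap hφC)
  simp only [h_fderiv] at h_test
  rw [← re_integral_mul_ofReal f ((continuous_partial i hφ).memLp_of_hasCompactSupport
    (hasCompactSupport_partial i hφ_supp)), h_test, Complex.neg_re,
    ← re_integral_mul_ofReal g (hφ.continuous.memLp_of_hasCompactSupport hφ_supp)]
  rfl

end WeakDerivative

section DerivSymbol

variable {E : Type*} [NormedAddCommGroup E] [InnerProductSpace ℝ E]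

/-- The Fourier symbol `2πi⟨ξ, e⟩` of the directional derivative `∂ₑ`, with the normalization
`e^{-2πi⟨x, ξ⟩}` of the Fourier transform. -/
noncomputable def derivSymbol (e ξ : E) : ℂ :=
  2 * Real.pi * Complex.I * (inner ℝ ξ e : ℝ)

theorem hasTemperateGrowth_derivSymbol (e : E) : (derivSymbol e).HasTemperateGrowth := by
  unfold derivSymbol
  fun_prop

theorem norm_derivSymbol_le (e ξ : E) : ‖derivSymbol e ξ‖ ≤ ‖e‖ * ‖(2 * Real.pi) • ξ‖ := by
  have h_inner : derivSymbol e ξ = Complex.I * (inner ℝ ((2 * Real.pi) • ξ) e : ℝ) := by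
    rw [real_inner_smul_left, derivSymbol]
    push_cast
    ring
  rw [h_inner, norm_mul, Complex.norm_I, one_mul, Complex.norm_real, mul_comm ‖e‖]
  exact norm_inner_le_norm (𝕜 := ℝ) _ _

end DerivSymbol

section FourierMultiplier

variable {E : Type*} [NormedAddCommGroup E] [InnerProductSpace ℝ E] [FiniteDimensional ℝ E]
  [MeasurableSpace E] [BorelSpace E]

/-- The Fourier multipliers `𝓕⁻¹ f 𝓕` on `L²` with bounded continuous symbol `f`. -/
noncomputable def fourierMultiplier :
    (E →ᵇ ℂ) →⋆ₐ[ℂ] ((E →₂[volume] ℂ) →L[ℂ] (E →₂[volume] ℂ)) :=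
  (Lp.fourierTransformₗᵢ E ℂ).symm.conjStarAlgEquiv.toStarAlgHom.comp (mulOp volume)

theorem fourierMultiplier_apply (f : E →ᵇ ℂ) (ψ : E →₂[volume] ℂ) :
    fourierMultiplier f ψ = 𝓕⁻ (mulOp volume f (𝓕 ψ)) :=
  rfl

theorem norm_fourierMultiplier_le (f : E →ᵇ ℂ) : ‖fourierMultiplier f‖ ≤ ‖f‖ :=
  NonUnitalStarAlgHom.norm_apply_le fourierMultiplier f

theorem tendsto_fourierMultiplier {ι : Type*} {l : Filter ι} [l.IsCountablyGenerated]
    {m : ι → E →ᵇ ℂ} {m₀ : E →ᵇ ℂ} {C : ℝ} (hC : ∀ s ξ, ‖m s ξ‖ ≤ C)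
    (hm : ∀ ξ, Tendsto (fun s => m s ξ) l (𝓝 (m₀ ξ))) (ψ : E →₂[volume] ℂ) :
    Tendsto (fun s => fourierMultiplier (m s) ψ) l (𝓝 (fourierMultiplier m₀ ψ)) :=
  ((Lp.fourierTransformₗᵢ E ℂ).symm.continuous.tendsto _).comp (tendsto_mulOp hC hm (𝓕 ψ))

theorem hasDerivAt_fourierMultiplier {m : ℝ → E →ᵇ ℂ} {m' : E →ᵇ ℂ} {C t : ℝ}
    (hLip : ∀ s ξ, ‖m s ξ - m t ξ‖ ≤ C * |s - t|)
    (hm : ∀ ξ, HasDerivAt (fun s => m s ξ) (m' ξ) t) (ψ : E →₂[volume] ℂ) :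
    HasDerivAt (fun s => fourierMultiplier (m s) ψ) (fourierMultiplier m' ψ) t :=
  (((Lp.fourierTransformₗᵢ E ℂ).symm : (E →₂[volume] ℂ) →L[ℂ] (E →₂[volume] ℂ)).restrictScalars ℝ
    |>.hasFDerivAt.comp_hasDerivAt t (hasDerivAt_mulOp hLip hm (𝓕 ψ)))

theorem mulOp_toTemperedDistribution {f : E →ᵇ ℂ} (hf : (f : E → ℂ).HasTemperateGrowth)
    (ψ : E →₂[volume] ℂ) :
    (mulOp volume f ψ : 𝓢'(E, ℂ)) = TemperedDistribution.smulLeftCLM ℂ f (ψ : 𝓢'(E, ℂ)) := by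
  ext u
  rw [TemperedDistribution.smulLeftCLM_apply_apply, Lp.toTemperedDistribution_apply,
    Lp.toTemperedDistribution_apply]
  refine integral_congr_ae ?_
  filter_upwards [coeFn_mulOp f ψ] with x hx
  rw [hx, SchwartzMap.smulLeftCLM_apply_apply hf]
  simp only [smul_eq_mul]
  ring

theorem fourierMultiplier_toTemperedDistribution {f : E →ᵇ ℂ}
    (hf : (f : E → ℂ).HasTemperateGrowth) (ψ : E →₂[volume] ℂ) :
    (fourierMultiplier f ψ : 𝓢'(E, ℂ))
      = TemperedDistribution.fourierMultiplierCLM ℂ f (ψ : 𝓢'(E, ℂ)) := by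
  rw [fourierMultiplier_apply, TemperedDistribution.fourierMultiplierCLM_apply,
    ← Lp.fourierInv_toTemperedDistribution_eq, mulOp_toTemperedDistribution hf,
    Lp.fourier_toTemperedDistribution_eq]

theorem lineDeriv_eq_fourierMultiplierCLM_derivSymbol (e : E) (T : 𝓢'(E, ℂ)) :
    ∂_{e} T = TemperedDistribution.fourierMultiplierCLM ℂ (derivSymbol e) T := by
  have h_inner : (fun ξ : E => ((inner ℝ ξ e : ℝ) : ℂ)).HasTemperateGrowth := by fun_prop
  rw [TemperedDistribution.lineDeriv_eq_fourierMultiplierCLM, ← _root_.smul_apply,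
    ← TemperedDistribution.fourierMultiplierCLM_smul h_inner]
  rfl

theorem lineDeriv_fourierMultiplier {f g : E →ᵇ ℂ} (hf : (f : E → ℂ).HasTemperateGrowth)
    (hg : (g : E → ℂ).HasTemperateGrowth) {e : E} (hfg : ∀ ξ, g ξ = derivSymbol e ξ * f ξ)
    (ψ : E →₂[volume] ℂ) :
    ∂_{e} (fourierMultiplier f ψ : 𝓢'(E, ℂ)) = (fourierMultiplier g ψ : 𝓢'(E, ℂ)) := by
  rw [lineDeriv_eq_fourierMultiplierCLM_derivSymbol,
    fourierMultiplier_toTemperedDistribution hf, fourierMultiplier_toTemperedDistribution hg,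
    TemperedDistribution.fourierMultiplierCLM_fourierMultiplierCLM_apply hf
      (hasTemperateGrowth_derivSymbol e), funext hfg, mul_comm]
  rfl

theorem toTemperedDistribution_injective :
    Function.Injective fun ψ : E →₂[volume] ℂ => (ψ : 𝓢'(E, ℂ)) :=
  LinearMap.ker_eq_bot.1 (Lp.ker_toTemperedDistributionCLM_eq_bot (E := E) (μ := volume))

theorem fourierMultiplier_of_lineDeriv {f g : E →ᵇ ℂ} (hf : (f : E → ℂ).HasTemperateGrowth)
    (hg : (g : E → ℂ).HasTemperateGrowth) {e : E} (hfg : ∀ ξ, g ξ = derivSymbol e ξ * f ξ)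
    {ψ χ : E →₂[volume] ℂ} (h : ∂_{e} (ψ : 𝓢'(E, ℂ)) = (χ : 𝓢'(E, ℂ))) :
    fourierMultiplier f χ = fourierMultiplier g ψ := by
  refine toTemperedDistribution_injective ?_
  dsimp only
  rw [fourierMultiplier_toTemperedDistribution hf, fourierMultiplier_toTemperedDistribution hg,
    ← h, lineDeriv_eq_fourierMultiplierCLM_derivSymbol,
    TemperedDistribution.fourierMultiplierCLM_fourierMultiplierCLM_apply
      (hasTemperateGrowth_derivSymbol e) hf, funext hfg]
  rfl

end FourierMultiplier

section BesselSymbols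

variable {E : Type*} [NormedAddCommGroup E] [InnerProductSpace ℝ E]

/-- The Fourier symbol `1 + |2πξ|²` of `1 - Δ`. -/
noncomputable def besselWeight (ξ : E) : ℝ :=
  1 + ‖(2 * Real.pi) • ξ‖ ^ 2

theorem one_le_besselWeight (ξ : E) : 1 ≤ besselWeight ξ :=
  le_add_of_nonneg_right (by positivity)

theorem besselWeight_pos (ξ : E) : 0 < besselWeight ξ :=
  one_pos.trans_le (one_le_besselWeight ξ)

theorem ofReal_besselWeight_ne_zero (ξ : E) : (besselWeight ξ : ℂ) ≠ 0 :=
  Complex.ofReal_ne_zero.2 (besselWeight_pos ξ).ne'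

theorem continuous_besselWeight : Continuous (besselWeight : E → ℝ) := by
  unfold besselWeight
  fun_prop

/-- The bounded symbol `f / (1 + |2πξ|²)`, for `f` of at most quadratic growth. -/
noncomputable def divBesselWeight (f : E → ℂ) (hf : Continuous f) (C : ℝ)
    (hC : ∀ ξ, ‖f ξ‖ ≤ C * besselWeight ξ) : E →ᵇ ℂ :=
  ofNormedAddCommGroup (fun ξ => f ξ * ((besselWeight ξ)⁻¹ : ℝ))
    (hf.mul (Complex.continuous_ofReal.comp
      (continuous_besselWeight.inv₀ fun ξ => (besselWeight_pos ξ).ne'))) C fun ξ => by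
    rw [norm_mul, Complex.norm_real, norm_inv, Real.norm_of_nonneg (besselWeight_pos ξ).le]
    exact mul_inv_le_of_le_mul₀ (besselWeight_pos ξ).le
      (nonneg_of_mul_nonneg_left ((norm_nonneg _).trans (hC ξ)) (besselWeight_pos ξ)) (hC ξ)

theorem hasTemperateGrowth_divBesselWeight {f : E → ℂ} {hf : Continuous f} {C : ℝ}
    {hC : ∀ ξ, ‖f ξ‖ ≤ C * besselWeight ξ} (hf_growth : f.HasTemperateGrowth) :
    (divBesselWeight f hf C hC : E → ℂ).HasTemperateGrowth := by
  have h_inv : (fun ξ : E => (besselWeight ξ)⁻¹).HasTemperateGrowth := by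
    simpa only [Real.rpow_neg_one] using!
      (Function.hasTemperateGrowth_one_add_norm_sq_rpow E (-1)).comp
        ((2 * Real.pi) • ContinuousLinearMap.id ℝ E).hasTemperateGrowth
  exact hf_growth.mul (Function.Complex.hasTemperateGrowth_ofReal.comp h_inv)

/-- The symbol of `(1 - Δ)⁻¹`. -/
noncomputable def besselSymbol : E →ᵇ ℂ :=
  divBesselWeight (fun _ => 1) continuous_const 1 fun ξ => by
    simpa using one_le_besselWeight ξ

/-- The symbol of `∂ₑ (1 - Δ)⁻¹`. -/
noncomputable def besselGradSymbol (e : E) : E →ᵇ ℂ :=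
  divBesselWeight (derivSymbol e) (by unfold derivSymbol; fun_prop) ‖e‖ fun ξ =>
    (norm_derivSymbol_le e ξ).trans <| by
      gcongr
      unfold besselWeight
      nlinarith [norm_nonneg ((2 * Real.pi) • ξ)]

/-- The symbol of `∂ₑ ∂_d (1 - Δ)⁻¹`. -/
noncomputable def besselHessSymbol (d e : E) : E →ᵇ ℂ :=
  divBesselWeight (fun ξ => derivSymbol e ξ * derivSymbol d ξ)
    (by unfold derivSymbol; fun_prop) (‖e‖ * ‖d‖) fun ξ => by
    rw [norm_mul]
    calc ‖derivSymbol e ξ‖ * ‖derivSymbol d ξ‖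
        ≤ (‖e‖ * ‖(2 * Real.pi) • ξ‖) * (‖d‖ * ‖(2 * Real.pi) • ξ‖) := by
          gcongr <;> exact norm_derivSymbol_le _ ξ
      _ = ‖e‖ * ‖d‖ * ‖(2 * Real.pi) • ξ‖ ^ 2 := by ring
      _ ≤ ‖e‖ * ‖d‖ * besselWeight ξ := by
          gcongr
          exact le_add_of_nonneg_left zero_le_one

theorem besselSymbol_apply (ξ : E) : besselSymbol ξ = ((besselWeight ξ)⁻¹ : ℝ) :=
  one_mul _

theorem besselGradSymbol_apply (e ξ : E) :
    besselGradSymbol e ξ = derivSymbol e ξ * besselSymbol ξ := by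
  rw [besselSymbol_apply]
  rfl

theorem besselHessSymbol_apply (d e ξ : E) :
    besselHessSymbol d e ξ = derivSymbol e ξ * besselGradSymbol d ξ :=
  mul_assoc _ _ _

theorem hasTemperateGrowth_besselSymbol : (besselSymbol : E → ℂ).HasTemperateGrowth :=
  hasTemperateGrowth_divBesselWeight (.const 1)

theorem hasTemperateGrowth_besselGradSymbol (e : E) :
    (besselGradSymbol e : E → ℂ).HasTemperateGrowth :=
  hasTemperateGrowth_divBesselWeight (hasTemperateGrowth_derivSymbol e)

theorem hasTemperateGrowth_besselHessSymbol (d e : E) :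
    (besselHessSymbol d e : E → ℂ).HasTemperateGrowth :=
  hasTemperateGrowth_divBesselWeight
    ((hasTemperateGrowth_derivSymbol e).mul (hasTemperateGrowth_derivSymbol d))

theorem star_besselSymbol : star (besselSymbol : E →ᵇ ℂ) = besselSymbol := by
  ext ξ
  simp only [star_apply, besselSymbol_apply, RCLike.star_def, Complex.conj_ofReal]

theorem besselSymbol_sub_sum_besselHessSymbol {ι : Type*} [Fintype ι]
    (v : OrthonormalBasis ι ℝ E) :
    besselSymbol - ∑ i, besselHessSymbol (v i) (v i) = 1 := by
  ext ξ
  have h_sum : ∑ i, derivSymbol (v i) ξ ^ 2 = -‖(2 * Real.pi) • ξ‖ ^ 2 := by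
    rw [← Complex.ofReal_pow, ← v.sum_sq_inner_left ((2 * Real.pi) • ξ)]
    push_cast
    rw [← Finset.sum_neg_distrib]
    refine Finset.sum_congr rfl fun i _ => ?_
    rw [derivSymbol, real_inner_smul_left, mul_pow, mul_pow, Complex.I_sq]
    push_cast
    ring
  have h_weight := ofReal_besselWeight_ne_zero ξ
  simp only [coe_sub, coe_sum, Pi.sub_apply, Finset.sum_apply, besselHessSymbol_apply,
    besselGradSymbol_apply, ← mul_assoc, ← sq, ← Finset.sum_mul, h_sum, besselSymbol_apply,
    coe_one, Pi.one_apply, Complex.ofReal_inv]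
  rw [← one_sub_mul, mul_inv_eq_one₀ h_weight, besselWeight]
  push_cast
  ring

end BesselSymbols

section Resolvent

variable {n : ℕ}

/-- `H2.toL2` as a bounded operator. -/
noncomputable def H2.toL2CLM : H2 n →L[ℝ] L2 n :=
  ContinuousLinearMap.fst ℝ _ _ ∘L (H2 n).subtypeL

/-- `H2.laplacian` as a bounded operator. -/
noncomputable def H2.laplacianCLM : H2 n →L[ℝ] L2 n :=
  ∑ i, ContinuousLinearMap.proj i ∘L ContinuousLinearMap.proj i ∘L
    ContinuousLinearMap.snd ℝ _ _ ∘L ContinuousLinearMap.snd ℝ _ _ ∘L (H2 n).subtypeL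

theorem H2.laplacianCLM_apply (f : H2 n) : H2.laplacianCLM f = H2.laplacian f := by
  simp only [laplacianCLM, _root_.sum_apply]
  rfl

/-- The operator `ψ ↦ Re (f(D) ψ)`, where `f(D)` is the Fourier multiplier with symbol `f`. -/
noncomputable def reFourierMultiplier (f : Space n →ᵇ ℂ) : (Space n →₂[volume] ℂ) →L[ℝ] L2 n :=
  reL ∘L (fourierMultiplier f).restrictScalars ℝ

/-- The real part of `(1 - Δ)⁻¹ ψ`, with its first and second derivatives. -/
noncomputable def H2.reResolvent : (Space n →₂[volume] ℂ) →L[ℝ] H2 n :=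
  ((reFourierMultiplier besselSymbol).prod
    ((ContinuousLinearMap.pi fun i =>
        reFourierMultiplier (besselGradSymbol (EuclideanSpace.basisFun (Fin n) ℝ i))).prod
      (ContinuousLinearMap.pi fun i => ContinuousLinearMap.pi fun j =>
        reFourierMultiplier (besselHessSymbol (EuclideanSpace.basisFun (Fin n) ℝ i)
          (EuclideanSpace.basisFun (Fin n) ℝ j))))).codRestrict (H2 n) fun ψ =>
    ⟨fun i => hasWeakPartial_reL <| by
      simpa only [EuclideanSpace.basisFun_apply] using!
        lineDeriv_fourierMultiplier hasTemperateGrowth_besselSymbol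
          (hasTemperateGrowth_besselGradSymbol _) (besselGradSymbol_apply _) ψ,
    fun i j => hasWeakPartial_reL <| by
      simpa only [EuclideanSpace.basisFun_apply] using!
        lineDeriv_fourierMultiplier (hasTemperateGrowth_besselGradSymbol _)
          (hasTemperateGrowth_besselHessSymbol _ _) (besselHessSymbol_apply _ _) ψ⟩

theorem H2.toL2_reResolvent (ψ : Space n →₂[volume] ℂ) :
    H2.toL2 (H2.reResolvent ψ) = reL (fourierMultiplier besselSymbol ψ) :=
  rfl

theorem H2.reResolvent_sub_laplacian (ψ : Space n →₂[volume] ℂ) :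
    H2.toL2 (H2.reResolvent ψ) - H2.laplacian (H2.reResolvent ψ) = reL ψ := by
  have h_laplacian : H2.laplacian (H2.reResolvent ψ) = reL (fourierMultiplier
      (∑ i, besselHessSymbol (EuclideanSpace.basisFun (Fin n) ℝ i)
        (EuclideanSpace.basisFun (Fin n) ℝ i)) ψ) := by
    rw [map_sum, _root_.sum_apply, map_sum]
    rfl
  rw [h_laplacian, H2.toL2_reResolvent, ← map_sub, ← _root_.sub_apply, ← map_sub,
    besselSymbol_sub_sum_besselHessSymbol, map_one, one_apply_eq_self]

/-- The resolvent `(1 - Δ)⁻¹ : L² → H²`. -/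
noncomputable def H2.resolvent : L2 n →L[ℝ] H2 n :=
  H2.reResolvent ∘L toC

theorem H2.toL2_resolvent (f : L2 n) :
    H2.toL2 (H2.resolvent f) = reL (fourierMultiplier besselSymbol (toC f)) :=
  rfl

theorem H2.resolvent_sub_laplacian (f : L2 n) :
    H2.toL2 (H2.resolvent f) - H2.laplacian (H2.resolvent f) = f :=
  (H2.reResolvent_sub_laplacian (toC f)).trans (reL_toC f)

theorem fourierMultiplier_besselSymbol_toC_sub_laplacian (f : H2 n) :
    fourierMultiplier besselSymbol (toC (H2.toL2 f - H2.laplacian f)) = toC (H2.toL2 f) := by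
  have h_hess (i : Fin n) :
      fourierMultiplier besselSymbol (toC (f.1.2.2 i i))
        = fourierMultiplier (besselHessSymbol (EuclideanSpace.basisFun (Fin n) ℝ i)
          (EuclideanSpace.basisFun (Fin n) ℝ i)) (toC (H2.toL2 f)) := by
    rw [EuclideanSpace.basisFun_apply]
    exact (fourierMultiplier_of_lineDeriv hasTemperateGrowth_besselSymbol
      (hasTemperateGrowth_besselGradSymbol _) (besselGradSymbol_apply _)
      (f.2.2 i i).lineDeriv_toC).trans
      (fourierMultiplier_of_lineDeriv (hasTemperateGrowth_besselGradSymbol _)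
        (hasTemperateGrowth_besselHessSymbol _ _) (besselHessSymbol_apply _ _)
        (f.2.1 i).lineDeriv_toC)
  have h_laplacian : fourierMultiplier besselSymbol (toC (H2.laplacian f)) = fourierMultiplier
      (∑ i, besselHessSymbol (EuclideanSpace.basisFun (Fin n) ℝ i)
        (EuclideanSpace.basisFun (Fin n) ℝ i)) (toC (H2.toL2 f)) := by
    simp only [H2.laplacian, map_sum, h_hess, _root_.sum_apply]
  rw [map_sub, map_sub, h_laplacian, ← _root_.sub_apply, ← map_sub,
    besselSymbol_sub_sum_besselHessSymbol, map_one, one_apply_eq_self]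

theorem H2.resolvent_toL2_sub_laplacian (f : H2 n) :
    H2.resolvent (H2.toL2 f - H2.laplacian f) = f :=
  H2.toL2_injective <| by
    rw [H2.toL2_resolvent, fourierMultiplier_besselSymbol_toC_sub_laplacian, reL_toC]

/-- The resolvent commutes with complex conjugation. -/
theorem H2.resolvent_reL (ψ : Space n →₂[volume] ℂ) : H2.resolvent (reL ψ) = H2.reResolvent ψ := by
  rw [← H2.reResolvent_sub_laplacian ψ, H2.resolvent_toL2_sub_laplacian]

theorem H2.inner_toL2_resolvent_comm (f g : L2 n) :
    inner ℝ (H2.toL2 (H2.resolvent f)) g = inner ℝ f (H2.toL2 (H2.resolvent g)) := by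
  rw [real_inner_comm _ f, H2.toL2_resolvent, H2.toL2_resolvent, inner_reL, inner_reL,
    ← inner_conj_symm, Complex.conj_re, ← ContinuousLinearMap.adjoint_inner_left,
    ← ContinuousLinearMap.star_eq_adjoint, ← map_star, star_besselSymbol]

theorem H2.inner_laplacian_comm (f g : H2 n) :
    inner ℝ (H2.laplacian f) (H2.toL2 g) = inner ℝ (H2.toL2 f) (H2.laplacian g) := by
  have h_symm := H2.inner_toL2_resolvent_comm (H2.toL2 f - H2.laplacian f)
    (H2.toL2 g - H2.laplacian g)
  rw [H2.resolvent_toL2_sub_laplacian, H2.resolvent_toL2_sub_laplacian, inner_sub_left,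
    inner_sub_right] at h_symm
  linarith

end Resolvent

section SchrodingerGroup

variable {X : Type*} [TopologicalSpace X]

/-- The bounded function `e^{-itw}`. -/
noncomputable def phase (w : C(X, ℝ)) (t : ℝ) : X →ᵇ ℂ :=
  ofNormedAddCommGroup (fun x => Complex.exp ((-(t * w x) : ℝ) * Complex.I)) (by fun_prop) 1
    fun x => (Complex.norm_exp_ofReal_mul_I _).le

variable {w : C(X, ℝ)}

theorem phase_apply (t : ℝ) (x : X) :
    phase w t x = Complex.exp ((-(t * w x) : ℝ) * Complex.I) :=
  rfl

theorem norm_phase_apply (t : ℝ) (x : X) : ‖phase w t x‖ = 1 :=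
  Complex.norm_exp_ofReal_mul_I _

theorem phase_zero : phase w 0 = 1 := by
  ext x
  simp [phase_apply]

theorem phase_mul_phase_neg (t : ℝ) : phase w t * phase w (-t) = 1 := by
  ext x
  rw [coe_mul, Pi.mul_apply, phase_apply, phase_apply, ← Complex.exp_add]
  simp

theorem norm_phase_sub_le (s t : ℝ) (x : X) :
    ‖phase w s x - phase w t x‖ ≤ |s - t| * |w x| := by
  have h_factor : phase w s x - phase w t x
      = phase w t x * (Complex.exp (Complex.I * ((t - s) * w x : ℝ)) - 1) := by
    rw [mul_sub_one, phase_apply, phase_apply, ← Complex.exp_add]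
    congr 2
    push_cast
    ring
  rw [h_factor, norm_mul, norm_phase_apply, one_mul, abs_sub_comm, ← abs_mul]
  exact Real.norm_exp_I_mul_ofReal_sub_one_le

theorem hasDerivAt_phase_apply (t : ℝ) (x : X) :
    HasDerivAt (fun s => phase w s x) (-(w x * Complex.I * phase w t x)) t := by
  have h_exponent : HasDerivAt (fun s : ℝ => ((-(s * w x) : ℝ) : ℂ) * Complex.I)
      ((-(1 * w x) : ℝ) * Complex.I) t :=
    ((hasDerivAt_id t).mul_const (w x)).neg.ofReal_comp.mul_const Complex.I
  convert! h_exponent.cexp using 1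
  rw [phase_apply]
  push_cast
  ring

variable {E : Type*} [NormedAddCommGroup E] [InnerProductSpace ℝ E]

/-- `besselWeight` as a continuous map. -/
noncomputable def besselWeightMap : C(E, ℝ) :=
  ⟨besselWeight, continuous_besselWeight⟩

theorem hasDerivAt_besselSymbol_mul_phase (t : ℝ) (ξ : E) :
    HasDerivAt (fun s => (besselSymbol * phase besselWeightMap s : E →ᵇ ℂ) ξ)
      ((-Complex.I • phase besselWeightMap t) ξ) t := by
  convert! (hasDerivAt_phase_apply t ξ).const_mul (besselSymbol ξ) using 1
  have h_weight := ofReal_besselWeight_ne_zero ξ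
  simp only [besselSymbol_apply, coe_smul, smul_eq_mul, besselWeightMap, ContinuousMap.coe_mk,
    Complex.ofReal_inv]
  field_simp

theorem norm_besselSymbol_mul_phase_sub_le (s t : ℝ) (ξ : E) :
    ‖(besselSymbol * phase besselWeightMap s : E →ᵇ ℂ) ξ
      - (besselSymbol * phase besselWeightMap t : E →ᵇ ℂ) ξ‖ ≤ 1 * |s - t| := by
  rw [coe_mul, coe_mul, Pi.mul_apply, Pi.mul_apply, ← mul_sub, norm_mul, besselSymbol_apply,
    Complex.norm_real, norm_inv, Real.norm_of_nonneg (besselWeight_pos ξ).le, one_mul,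
    inv_mul_le_iff₀ (besselWeight_pos ξ), mul_comm]
  refine (norm_phase_sub_le s t ξ).trans_eq ?_
  rw [besselWeightMap, ContinuousMap.coe_mk, abs_of_pos (besselWeight_pos ξ)]

variable [FiniteDimensional ℝ E] [MeasurableSpace E] [BorelSpace E]

/-- The Schrödinger group `e^{-it(1-Δ)}` on `L²`. -/
noncomputable def schrodinger (t : ℝ) : (E →₂[volume] ℂ) →L[ℂ] (E →₂[volume] ℂ) :=
  fourierMultiplier (phase besselWeightMap t)

theorem continuous_schrodinger_apply (ψ : E →₂[volume] ℂ) :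
    Continuous fun t => schrodinger t ψ :=
  continuous_iff_continuousAt.2 fun t =>
    tendsto_fourierMultiplier (fun s ξ => (norm_phase_apply s ξ).le)
      (fun ξ => (hasDerivAt_phase_apply t ξ).continuousAt) ψ

theorem norm_schrodinger_le (t : ℝ) : ‖(schrodinger t : (E →₂[volume] ℂ) →L[ℂ] _)‖ ≤ 1 :=
  (norm_fourierMultiplier_le _).trans
    ((norm_le zero_le_one).2 fun ξ => (norm_phase_apply t ξ).le)

theorem schrodinger_zero : (schrodinger 0 : (E →₂[volume] ℂ) →L[ℂ] _) = 1 := by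
  rw [schrodinger, phase_zero, map_one]

theorem schrodinger_mul_schrodinger_neg (t : ℝ) :
    (schrodinger t * schrodinger (-t) : (E →₂[volume] ℂ) →L[ℂ] _) = 1 := by
  rw [schrodinger, schrodinger, ← map_mul, phase_mul_phase_neg, map_one]

theorem hasDerivAt_besselSymbol_schrodinger (ψ : E →₂[volume] ℂ) (t : ℝ) :
    HasDerivAt (fun s => fourierMultiplier besselSymbol (schrodinger s ψ))
      (-Complex.I • schrodinger t ψ) t := by
  have h_deriv := hasDerivAt_fourierMultiplier
    (fun s ξ => norm_besselSymbol_mul_phase_sub_le s t ξ)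
    (hasDerivAt_besselSymbol_mul_phase t) ψ
  simpa only [map_mul, map_smul, mul_apply_eq_comp, _root_.smul_apply] using! h_deriv

end SchrodingerGroup

section Existence

variable {n : ℕ}

theorem fourierMultiplier_besselSymbol_toC (f : L2 n) :
    fourierMultiplier besselSymbol (toC f) = toC (H2.toL2 (H2.resolvent f)) := by
  have h_inverse := fourierMultiplier_besselSymbol_toC_sub_laplacian (H2.resolvent f)
  rwa [H2.resolvent_sub_laplacian] at h_inverse

theorem reL_neg_I_smul_toC (f : L2 n) : reL (-Complex.I • toC f) = 0 := by
  rw [neg_smul, map_neg, reL_I_smul_toC, neg_zero]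

theorem exists_perturbed_schrodinger_orbit (K : H2 n →L[ℝ] L2 n) (ψ₀ : Space n →₂[volume] ℂ) :
    ∃ ψ : ℝ → (Space n →₂[volume] ℂ), Continuous ψ ∧ ψ 0 = ψ₀ ∧ ∀ t,
      HasDerivAt (fun s => fourierMultiplier besselSymbol (ψ s))
        (-Complex.I • ψ t
          + Complex.I • toC (H2.toL2 (H2.resolvent (K (H2.reResolvent (ψ t)))))) t := by
  obtain ⟨ψ, hψ_cont, hψ_zero, hψ⟩ := exists_perturbed_group_orbit
    (U := fun t => (schrodinger t : (Space n →₂[volume] ℂ) →L[ℂ] _).restrictScalars ℝ)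
    (M := (fourierMultiplier besselSymbol).restrictScalars ℝ)
    (A := ContinuousLinearMap.lsmul ℝ ℂ (-Complex.I))
    continuous_schrodinger_apply norm_schrodinger_le
    (by rw [schrodinger_zero]; rfl)
    (fun t => ContinuousLinearMap.ext fun ψ =>
      DFunLike.congr_fun (schrodinger_mul_schrodinger_neg t) ψ)
    hasDerivAt_besselSymbol_schrodinger
    (ContinuousLinearMap.lsmul ℝ ℂ Complex.I ∘L toC ∘L K ∘L H2.reResolvent) ψ₀
  refine ⟨ψ, hψ_cont, hψ_zero, fun t => ?_⟩
  rw [← fourierMultiplier_besselSymbol_toC, ← map_smul]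
  exact hψ t

theorem exists_resolvent_wave_orbit (K : H2 n →L[ℝ] L2 n) (u₀ : H2 n) (v₀ : L2 n) :
    ∃ (u : ℝ → H2 n) (v : ℝ → L2 n), Continuous u ∧ Continuous v ∧ u 0 = u₀ ∧ v 0 = v₀ ∧
      (∀ t, HasDerivAt (fun s => H2.toL2 (u s)) (v t) t) ∧
      ∀ t, HasDerivAt (fun s => H2.toL2 (H2.resolvent (v s)))
        (-(H2.toL2 (u t) - H2.laplacian (u t)) + H2.toL2 (H2.resolvent (K (u t)))) t := by
  obtain ⟨ψ, hψ_cont, hψ_zero, hψ⟩ := exists_perturbed_schrodinger_orbit K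
    (toC (H2.toL2 u₀ - H2.laplacian u₀) + Complex.I • toC v₀)
  refine ⟨fun t => H2.reResolvent (ψ t), fun t => reL (-Complex.I • ψ t),
    H2.reResolvent.continuous.comp hψ_cont, by fun_prop, ?_, ?_,
    fun t => ?_, fun t => ?_⟩
  · dsimp only
    rw [hψ_zero, ← H2.resolvent_reL, map_add, reL_toC, reL_I_smul_toC, add_zero,
      H2.resolvent_toL2_sub_laplacian]
  · dsimp only
    rw [hψ_zero, smul_add, map_add, reL_neg_I_smul_toC, smul_smul, neg_mul, Complex.I_mul_I,
      neg_neg, one_smul, reL_toC, zero_add]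
  · have h_re := reL.hasFDerivAt.comp_hasDerivAt t (hψ t)
    rwa [map_add, reL_I_smul_toC, add_zero] at h_re
  · have h_conj (s : ℝ) : H2.toL2 (H2.resolvent (reL (-Complex.I • ψ s)))
        = reL (-Complex.I • fourierMultiplier besselSymbol (ψ s)) := by
      rw [H2.resolvent_reL, H2.toL2_reResolvent, map_smul]
    have h_rotate (g : L2 n) : -Complex.I • (-Complex.I • ψ t + Complex.I • toC g)
        = -ψ t + toC g := by
      rw [smul_add, smul_smul, smul_smul, neg_mul_neg, neg_mul, Complex.I_mul_I, neg_neg, one_smul,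
        neg_one_smul]
    have h_im : HasDerivAt (fun s => -Complex.I • fourierMultiplier besselSymbol (ψ s))
        (-ψ t + toC (H2.toL2 (H2.resolvent (K (H2.reResolvent (ψ t)))))) t := by
      rw [← h_rotate]
      exact (hψ t).const_smul (-Complex.I)
    have h_reL := reL.hasFDerivAt.comp_hasDerivAt t h_im
    refine (h_reL.congr_of_eventuallyEq (.of_forall h_conj)).congr_deriv ?_
    rw [map_add, map_neg, reL_toC, H2.reResolvent_sub_laplacian]

/-- The operator `u ↦ u - 2Δu - Vu`: the equation `u_tt + Δ²u + Vu = 0` reads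
`u_tt + (1 - Δ)²u = u - 2Δu - Vu`. -/
noncomputable def lowerOrder (V : Space n →ᵇ ℝ) : H2 n →L[ℝ] L2 n :=
  H2.toL2CLM - (2 : ℝ) • H2.laplacianCLM - mulOp volume V ∘L H2.toL2CLM

theorem lowerOrder_apply (V : Space n →ᵇ ℝ) (f : H2 n) :
    lowerOrder V f = H2.toL2 f - (2 : ℝ) • H2.laplacian f - mulOp volume V (H2.toL2 f) := by
  rw [← H2.laplacianCLM_apply]
  rfl

theorem inner_resolvent_wave (V : Space n →ᵇ ℝ) (f φ : H2 n) :
    inner ℝ (-(H2.toL2 f - H2.laplacian f) + H2.toL2 (H2.resolvent (lowerOrder V f)))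
        (H2.toL2 φ - H2.laplacian φ)
      = -(inner ℝ (H2.laplacian f) (H2.laplacian φ)
        + ∫ x, V x * H2.toL2 f x * H2.toL2 φ x) := by
  rw [inner_add_left, H2.inner_toL2_resolvent_comm, H2.resolvent_toL2_sub_laplacian,
    lowerOrder_apply, ← inner_mulOp]
  simp only [inner_neg_left, inner_sub_left, inner_sub_right, real_inner_smul_left,
    H2.inner_laplacian_comm]
  ring

theorem exists_isWeakSolution (V : Space n →ᵇ ℝ) (u₀ : H2 n) (u₁ : L2 n) :
    ∃ u, IsWeakSolution V u₀ u₁ u := by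
  obtain ⟨u, v, hu_cont, hv_cont, hu_zero, hv_zero, hu, hv⟩ :=
    exists_resolvent_wave_orbit (lowerOrder V) u₀ u₁
  have h_timeDeriv {t : ℝ} (ht : 0 ≤ t) : timeDeriv u t = v t :=
    (hu t).hasDerivWithinAt.derivWithin (uniqueDiffOn_Ici 0 t ht)
  have h_contDiff : ContDiff ℝ 1 fun t => H2.toL2 (u t) :=
    contDiff_one_iff_deriv.2 ⟨fun t => (hu t).differentiableAt, by
      rwa [funext fun t => (hu t).deriv]⟩
  refine ⟨u, hu_cont.continuousOn, h_contDiff.contDiffOn, hu_zero,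
    (h_timeDeriv le_rfl).trans hv_zero, fun φ t ht => ?_⟩
  have h_inner : HasDerivAt (fun s => inner ℝ (v s) (H2.toL2 φ)) (-(inner ℝ (H2.laplacian (u t))
      (H2.laplacian φ) + ∫ x, V x * H2.toL2 (u t) x * H2.toL2 φ x)) t := by
    have h_resolvent := (hv t).inner ℝ (hasDerivAt_const t (H2.toL2 φ - H2.laplacian φ))
    simpa only [inner_zero_right, zero_add, inner_resolvent_wave, H2.inner_toL2_resolvent_comm,
      H2.resolvent_toL2_sub_laplacian] using h_resolvent
  refine h_inner.congr_of_eventuallyEq ?_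
  filter_upwards [Ioi_mem_nhds ht] with s hs
  rw [h_timeDeriv hs.le]

end Existence

theorem eq_of_hasDerivAt_zero {g : ℝ → ℝ} (hg_cont : ContinuousOn g (Ici 0))
    (hg : ∀ t, 0 < t → HasDerivAt g 0 t) {t : ℝ} (ht : 0 ≤ t) : g t = g 0 := by
  rcases ht.eq_or_lt with rfl | ht
  · rfl
  obtain ⟨c, -, hc⟩ := exists_hasDerivAt_eq_slope g (fun _ => 0) ht
    (hg_cont.mono Icc_subset_Ici_self) fun x hx => hg x hx.1
  rw [eq_div_iff (by simpa using ht.ne')] at hc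
  linarith

section TimePrimitive

variable {E : Type*} [NormedAddCommGroup E] [NormedSpace ℝ E]

/-- The primitive `∫₀ᵗ v(s) ds` of a curve `v` on `[0, ∞)`. Only values of `v` on `[0, ∞)` enter,
so that for `v` continuous on `[0, ∞)` it has a two-sided derivative at `0` as well. -/
noncomputable def timePrimitive (v : ℝ → E) (t : ℝ) : E :=
  ∫ s in (0 : ℝ)..t, v (max s 0)

theorem timePrimitive_zero (v : ℝ → E) : timePrimitive v 0 = 0 :=
  intervalIntegral.integral_same

theorem hasDerivAt_timePrimitive [CompleteSpace E] {v : ℝ → E} (hv : ContinuousOn v (Ici 0))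
    {t : ℝ} (ht : 0 ≤ t) : HasDerivAt (timePrimitive v) (v t) t := by
  have h_cont : Continuous fun s => v (max s 0) :=
    hv.comp_continuous (by fun_prop) fun s => le_max_right s 0
  simpa only [max_eq_left ht] using! (h_cont.integral_hasStrictDerivAt 0 t).hasDerivAt

theorem continuousOn_timePrimitive [CompleteSpace E] {v : ℝ → E} (hv : ContinuousOn v (Ici 0)) :
    ContinuousOn (timePrimitive v) (Ici 0) :=
  fun _ ht => (hasDerivAt_timePrimitive hv ht).continuousAt.continuousWithinAt

end TimePrimitive

section Potential

variable {X : Type*} [TopologicalSpace X] [MeasurableSpace X] [BorelSpace X] {μ : Measure X}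
  {V : X →ᵇ ℝ}

theorem inner_mulOp_self_nonneg (hV : ∀ x, 0 ≤ V x) (f : Lp ℝ 2 μ) :
    0 ≤ inner ℝ (mulOp μ V f) f := by
  rw [inner_mulOp]
  exact integral_nonneg fun x => by
    simpa only [Pi.zero_apply, mul_assoc] using mul_nonneg (hV x) (mul_self_nonneg (f x))

theorem two_mul_mul_le_sq_div_add {v : ℝ} (hv : 0 < v) (a b : ℝ) :
    2 * (a * b) ≤ |a| ^ 2 / v + v * b * b := by
  have h_square : |a| ^ 2 / v + v * b * b - 2 * (a * b) = (a - v * b) ^ 2 / v := by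
    rw [sq_abs]
    field_simp
    ring
  have h_nonneg : 0 ≤ (a - v * b) ^ 2 / v := by positivity
  linarith

theorem two_mul_inner_le_integral_sq_div_add {Ω : Set X} (hΩ : MeasurableSet Ω)
    (hV_pos : ∀ x ∈ Ω, 0 < V x) (hV : ∀ x, 0 ≤ V x) {f : Lp ℝ 2 μ}
    (hf : ∀ᵐ x ∂μ, x ∉ Ω → f x = 0) (hf_int : IntegrableOn (fun x => |f x| ^ 2 / V x) Ω μ)
    (g : Lp ℝ 2 μ) :
    2 * inner ℝ f g ≤ (∫ x in Ω, |f x| ^ 2 / V x ∂μ) + inner ℝ (mulOp μ V g) g := by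
  have h_potential : Integrable (fun x => V x * g x * g x) μ := by
    refine ((Lp.memLp (mulOp μ V g)).integrable_mul (q := 2) (Lp.memLp g)).congr ?_
    filter_upwards [coeFn_mulOp V g] with x hx
    rw [Pi.mul_apply, hx]
  have h_product : Integrable (fun x => f x * g x) μ :=
    (Lp.memLp f).integrable_mul (q := 2) (Lp.memLp g)
  have h_inner : inner ℝ f g = ∫ x, f x * g x ∂μ := by
    simp only [L2.inner_def, Real.inner_apply]
  have h_indicator := (integrable_indicator_iff hΩ).2 hf_int
  rw [h_inner, inner_mulOp, ← integral_indicator hΩ, ← integral_const_mul,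
    ← integral_add h_indicator h_potential]
  refine integral_mono_ae (h_product.const_mul 2) (h_indicator.add h_potential) ?_
  filter_upwards [hf] with x hx
  by_cases hxΩ : x ∈ Ω
  · simpa only [indicator_of_mem hxΩ] using two_mul_mul_le_sq_div_add (hV_pos x hxΩ) (f x) (g x)
  · simpa only [indicator_of_notMem hxΩ, hx hxΩ, zero_mul, mul_zero, zero_add, mul_assoc] using
      mul_nonneg (hV x) (mul_self_nonneg (g x))

end Potential

section Energy

variable {n : ℕ} {V : Space n →ᵇ ℝ} {u₀ u₀' : H2 n} {u₁ u₁' : L2 n} {u u' : ℝ → H2 n}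

theorem H2.toL2_sub (f g : H2 n) : H2.toL2 (f - g) = H2.toL2 f - H2.toL2 g :=
  rfl

theorem H2.laplacian_sub (f g : H2 n) :
    H2.laplacian (f - g) = H2.laplacian f - H2.laplacian g := by
  simp only [← H2.laplacianCLM_apply, map_sub]

theorem H2.continuous_laplacian : Continuous (H2.laplacian (n := n)) :=
  H2.laplacianCLM.continuous.congr H2.laplacianCLM_apply

namespace IsWeakSolution

theorem hasDerivWithinAt (h : IsWeakSolution V u₀ u₁ u) {t : ℝ} (ht : 0 ≤ t) :
    HasDerivWithinAt (fun s => H2.toL2 (u s)) (timeDeriv u t) (Ici 0) t :=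
  (h.contDiffOn.differentiableOn one_ne_zero t ht).hasDerivWithinAt

theorem hasDerivAt (h : IsWeakSolution V u₀ u₁ u) {t : ℝ} (ht : 0 < t) :
    HasDerivAt (fun s => H2.toL2 (u s)) (timeDeriv u t) t :=
  (h.hasDerivWithinAt ht.le).hasDerivAt (Ici_mem_nhds ht)

theorem continuousOn_toL2 (h : IsWeakSolution V u₀ u₁ u) :
    ContinuousOn (fun t => H2.toL2 (u t)) (Ici 0) :=
  h.contDiffOn.continuousOn

theorem continuousOn_laplacian (h : IsWeakSolution V u₀ u₁ u) :
    ContinuousOn (fun t => H2.laplacian (u t)) (Ici 0) :=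
  H2.continuous_laplacian.comp_continuousOn h.continuousOn

theorem continuousOn_timeDeriv (h : IsWeakSolution V u₀ u₁ u) :
    ContinuousOn (timeDeriv u) (Ici 0) :=
  h.contDiffOn.continuousOn_derivWithin (uniqueDiffOn_Ici 0) le_rfl

theorem hasDerivAt_inner_timeDeriv (h : IsWeakSolution V u₀ u₁ u) (φ : H2 n) {t : ℝ}
    (ht : 0 < t) :
    HasDerivAt (fun s => inner ℝ (timeDeriv u s) (H2.toL2 φ))
      (-(inner ℝ (H2.laplacian (u t)) (H2.laplacian φ)
        + inner ℝ (mulOp volume V (H2.toL2 (u t))) (H2.toL2 φ))) t := by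
  rw [inner_mulOp]
  exact h.weak φ t ht

theorem sub (h : IsWeakSolution V u₀ u₁ u) (h' : IsWeakSolution V u₀' u₁' u') :
    IsWeakSolution V (u₀ - u₀') (u₁ - u₁') (fun t => u t - u' t) := by
  have h_timeDeriv {t : ℝ} (ht : 0 ≤ t) :
      timeDeriv (fun t => u t - u' t) t = timeDeriv u t - timeDeriv u' t :=
    ((h.hasDerivWithinAt ht).sub (h'.hasDerivWithinAt ht)).derivWithin (uniqueDiffOn_Ici 0 t ht)
  refine ⟨h.continuousOn.sub h'.continuousOn, h.contDiffOn.sub h'.contDiffOn,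
    by rw [h.init, h'.init], by rw [h_timeDeriv le_rfl, h.init_deriv, h'.init_deriv],
    fun φ t ht => ?_⟩
  have h_eventually : (fun s => inner ℝ (timeDeriv (fun t => u t - u' t) s) (H2.toL2 φ))
      =ᶠ[𝓝 t] fun s => inner ℝ (timeDeriv u s) (H2.toL2 φ)
        - inner ℝ (timeDeriv u' s) (H2.toL2 φ) := by
    filter_upwards [Ioi_mem_nhds ht] with s hs
    rw [h_timeDeriv (le_of_lt hs), inner_sub_left]
  refine (((h.hasDerivAt_inner_timeDeriv φ ht).sub (h'.hasDerivAt_inner_timeDeriv φ ht)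
    ).congr_of_eventuallyEq h_eventually).congr_deriv ?_
  rw [← inner_mulOp, H2.toL2_sub, H2.laplacian_sub, map_sub, inner_sub_left, inner_sub_left]
  ring

/-- Integrating in time removes `u_tt` from the equation, so that `φ = u(t)` can be inserted below
although `u_t` is only in `L²`. -/
theorem inner_timeDeriv_add (h : IsWeakSolution V u₀ u₁ u) (φ : H2 n) {t : ℝ} (ht : 0 ≤ t) :
    inner ℝ (timeDeriv u t) (H2.toL2 φ)
      + inner ℝ (timePrimitive (fun s => H2.laplacian (u s)) t) (H2.laplacian φ)
      + inner ℝ (mulOp volume V (timePrimitive (fun s => H2.toL2 (u s)) t)) (H2.toL2 φ)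
      = inner ℝ u₁ (H2.toL2 φ) := by
  set D := timePrimitive fun s => H2.laplacian (u s) with hD
  set W := timePrimitive fun s => H2.toL2 (u s) with hW
  have h_const : inner ℝ (timeDeriv u t) (H2.toL2 φ) + inner ℝ (D t) (H2.laplacian φ)
      + inner ℝ (mulOp volume V (W t)) (H2.toL2 φ)
      = inner ℝ (timeDeriv u 0) (H2.toL2 φ) + inner ℝ (D 0) (H2.laplacian φ)
      + inner ℝ (mulOp volume V (W 0)) (H2.toL2 φ) := by
    refine eq_of_hasDerivAt_zero (g := fun s => inner ℝ (timeDeriv u s) (H2.toL2 φ)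
      + inner ℝ (D s) (H2.laplacian φ) + inner ℝ (mulOp volume V (W s)) (H2.toL2 φ)) ?_ ?_ ht
    · exact ((h.continuousOn_timeDeriv.inner continuousOn_const).add
        ((continuousOn_timePrimitive h.continuousOn_laplacian).inner continuousOn_const)).add
        (((mulOp volume V).continuous.comp_continuousOn
          (continuousOn_timePrimitive h.continuousOn_toL2)).inner continuousOn_const)
    · intro s hs
      have hD_deriv := (hasDerivAt_timePrimitive h.continuousOn_laplacian hs.le).inner ℝ
        (hasDerivAt_const s (H2.laplacian φ))
      have hVW_deriv := ((mulOp volume V).hasFDerivAt.comp_hasDerivAt s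
        (hasDerivAt_timePrimitive h.continuousOn_toL2 hs.le)).inner ℝ
        (hasDerivAt_const s (H2.toL2 φ))
      refine (((h.hasDerivAt_inner_timeDeriv φ hs).add hD_deriv).add hVW_deriv).congr_deriv ?_
      rw [inner_zero_right, inner_zero_right]
      ring
  rw [h_const, hD, hW, timePrimitive_zero, timePrimitive_zero, map_zero, inner_zero_left,
    inner_zero_left, add_zero, add_zero, h.init_deriv]

theorem energy_timePrimitive (h : IsWeakSolution V u₀ u₁ u) {t : ℝ} (ht : 0 ≤ t) :
    ‖H2.toL2 (u t)‖ ^ 2 + ‖timePrimitive (fun s => H2.laplacian (u s)) t‖ ^ 2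
      + inner ℝ (mulOp volume V (timePrimitive (fun s => H2.toL2 (u s)) t))
        (timePrimitive (fun s => H2.toL2 (u s)) t)
      = ‖H2.toL2 u₀‖ ^ 2 + 2 * inner ℝ u₁ (timePrimitive (fun s => H2.toL2 (u s)) t) := by
  set D := timePrimitive fun s => H2.laplacian (u s) with hD
  set W := timePrimitive fun s => H2.toL2 (u s) with hW
  have hD_cont := continuousOn_timePrimitive h.continuousOn_laplacian
  have hW_cont := continuousOn_timePrimitive h.continuousOn_toL2
  have h_const := eq_of_hasDerivAt_zero (g := fun s => ‖H2.toL2 (u s)‖ ^ 2 + ‖D s‖ ^ 2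
      + inner ℝ (mulOp volume V (W s)) (W s) - 2 * inner ℝ u₁ (W s)) ?_ ?_ ht
  · simp only [hD, hW, timePrimitive_zero, h.init, inner_zero_right, norm_zero] at h_const
    linarith
  · exact (((h.continuousOn_toL2.norm.pow 2).add (hD_cont.norm.pow 2)).add
      (((mulOp volume V).continuous.comp_continuousOn hW_cont).inner hW_cont)).sub
      (continuousOn_const.mul (continuousOn_const.inner hW_cont))
  · intro s hs
    have hD_deriv := hasDerivAt_timePrimitive h.continuousOn_laplacian hs.le
    have hW_deriv := hasDerivAt_timePrimitive h.continuousOn_toL2 hs.le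
    refine ((((h.hasDerivAt hs).norm_sq.add hD_deriv.norm_sq).add
      (((mulOp volume V).hasFDerivAt.comp_hasDerivAt s hW_deriv).inner ℝ hW_deriv)).sub
      (((hasDerivAt_const s u₁).inner ℝ hW_deriv).const_mul 2)).congr_deriv ?_
    have h_equation := h.inner_timeDeriv_add (u s) hs.le
    rw [Function.comp_apply, inner_zero_left, inner_mulOp_comm V (H2.toL2 (u s)),
      real_inner_comm (timeDeriv u s)]
    linarith

theorem unique (hV : ∀ x, 0 ≤ V x) (h : IsWeakSolution V u₀ u₁ u)
    (h' : IsWeakSolution V u₀ u₁ u') {t : ℝ} (ht : 0 ≤ t) : u t = u' t := by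
  have h_sub := h.sub h'
  rw [sub_self, sub_self] at h_sub
  have h_energy := h_sub.energy_timePrimitive ht
  have h_zero : H2.toL2 (0 : H2 n) = 0 := rfl
  rw [inner_zero_left, h_zero, norm_zero] at h_energy
  have h_potential := inner_mulOp_self_nonneg hV
    (timePrimitive (fun s => H2.toL2 (u s - u' s)) t)
  have h_norm : ‖H2.toL2 (u t - u' t)‖ ^ 2 = 0 := by
    linarith [sq_nonneg ‖H2.toL2 (u t - u' t)‖,
      sq_nonneg ‖timePrimitive (fun s => H2.laplacian (u s - u' s)) t‖]
  exact H2.toL2_injective (sub_eq_zero.1 (norm_eq_zero.1 (pow_eq_zero_iff two_ne_zero |>.1 h_norm)))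

theorem norm_sq_le (h : IsWeakSolution V u₀ u₁ u) {Ω : Set (Space n)} (hΩ : MeasurableSet Ω)
    (hV_pos : ∀ x ∈ Ω, 0 < V x) (hV : ∀ x, 0 ≤ V x) (hu₁ : ∀ᵐ x, x ∉ Ω → u₁ x = 0)
    (hu₁_int : IntegrableOn (fun x => |u₁ x| ^ 2 / V x) Ω) {t : ℝ} (ht : 0 ≤ t) :
    ‖H2.toL2 (u t)‖ ^ 2 ≤ ‖H2.toL2 u₀‖ ^ 2 + ∫ x in Ω, |u₁ x| ^ 2 / V x := by
  have h_energy := h.energy_timePrimitive ht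
  have h_young := two_mul_inner_le_integral_sq_div_add hΩ hV_pos hV hu₁ hu₁_int
    (timePrimitive (fun s => H2.toL2 (u s)) t)
  linarith [sq_nonneg ‖timePrimitive (fun s => H2.laplacian (u s)) t‖]

end IsWeakSolution

theorem ae_eq_zero_of_essSupp_subset {f : L2 n} {Ω : Set (Space n)} (hf : essSupp f ⊆ Ω) :
    ∀ᵐ x, x ∉ Ω → f x = 0 := by
  obtain ⟨T, hT_count, hT_sub, hT_union⟩ := TopologicalSpace.isOpen_sUnion_countable
    {U : Set (Space n) | IsOpen U ∧ ∀ᵐ x, x ∈ U → f x = 0} fun U hU => hU.1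
  filter_upwards [(ae_ball_iff hT_count).2 fun U hU => (hT_sub hU).2] with x hx hxΩ
  have hx_supp : x ∉ essSupp f := fun h => hxΩ (hf h)
  rw [essSupp, notMem_compl_iff, ← hT_union] at hx_supp
  obtain ⟨U, hU, hxU⟩ := hx_supp
  exact hx U hU hxU

end Energy

end PlateEq

theorem theorem1p8_general {n : ℕ} {Ω : Set (PlateEq.Space n)} (hΩ : MeasurableSet Ω)
    {V : PlateEq.Space n →ᵇ ℝ} (hV_pos : ∀ x ∈ Ω, 0 < V x) (hV : ∀ x, 0 ≤ V x)
    (u₀ : PlateEq.H2 n) {u₁ : PlateEq.L2 n} (hu₁ : ∀ᵐ x, x ∉ Ω → u₁ x = 0)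
    (hu₁_int : IntegrableOn (fun x => |u₁ x| ^ 2 / V x) Ω) :
    ∃ u : ℝ → PlateEq.H2 n,
      PlateEq.IsWeakSolution V u₀ u₁ u ∧
      (∀ w : ℝ → PlateEq.H2 n, PlateEq.IsWeakSolution V u₀ u₁ w → ∀ t : ℝ, 0 ≤ t → w t = u t) ∧
      ∀ t : ℝ, 0 ≤ t →
        ‖PlateEq.H2.toL2 (u t)‖ ^ 2
          ≤ ‖PlateEq.H2.toL2 u₀‖ ^ 2 + ∫ x in Ω, |u₁ x| ^ 2 / V x := by
  obtain ⟨u, hu⟩ := PlateEq.exists_isWeakSolution V u₀ u₁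
  exact ⟨u, hu, fun w hw t ht => hw.unique hV hu ht,
    fun t ht => hu.norm_sq_le hΩ hV_pos hV hu₁ hu₁_int ht⟩

theorem theorem1p8 :
    ∃ C : ℝ, 0 < C ∧
      ∀ (n : ℕ), 1 ≤ n →
      ∀ (Ω : Set (PlateEq.Space n)), IsOpen Ω →
      ∀ (V : PlateEq.Space n →ᵇ ℝ), (∀ x ∈ Ω, 0 < V x) → (∀ x, 0 ≤ V x) →
      ∀ (u₀ : PlateEq.H2 n) (u₁ : PlateEq.L2 n), PlateEq.essSupp u₁ ⊆ Ω →
        IntegrableOn (fun x => |u₁ x| ^ 2 / V x) Ω volume →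
        ∃ u : ℝ → PlateEq.H2 n,
          PlateEq.IsWeakSolution V u₀ u₁ u ∧
          (∀ w : ℝ → PlateEq.H2 n, PlateEq.IsWeakSolution V u₀ u₁ w →
            ∀ t : ℝ, 0 ≤ t → w t = u t) ∧
          ∀ t : ℝ, 0 ≤ t →
            ‖PlateEq.H2.toL2 (u t)‖ ^ 2 ≤ C * (‖PlateEq.H2.toL2 u₀‖ ^ 2 + ∫ x in Ω, |u₁ x| ^ 2 / V x) := by
  refine ⟨1, one_pos, fun n _ Ω hΩ V hV_pos hV u₀ u₁ hu₁ hu₁_int => ?_⟩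
  simpa only [one_mul] using theorem1p8_general hΩ.measurableSet hV_pos hV u₀
    (PlateEq.ae_eq_zero_of_essSupp_subset hu₁) hu₁_int
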